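/- **Setting.** Norms on $\mathbb R^n$ are $\ell^2$, $\|\cdot\|_{op}$ is the operator norm. *Networks.* Fix finitely many nonlinearities $\sigma_1,\dots,\sigma_s:\mathbb C\to\mathbb C$, at least one of which maps $\mathbb R$ to $\mathbb R$ and is on $\mathbb R$ a $C^\infty$ function that is not a polynomial; the others are arbitrary. A neural network is a map $y\mapsto W_L\,\rho_{L-1}(V_{L-1}(\cdots\rho_1(V_1(y))\cdots))+Ry+c$ with affine maps $V_j$, where each $\rho_j$ applies one of the $\sigma$'s to the coordinates in some index set and leaves the other coordinates unchanged. For $U\subset\mathbb R^m$, $\mathcal{NN}_{m,N}$ is the set of maps $\mathbb R^m\to\mathbb R^N$ that are restrictions of such networks and are bounded on $U$, with $d(\varphi,\psi)=\sup_{y\in U}\|\varphi(y)-\psi(y)\|$. *Optimal maps.* For linear $A:\mathbb R^N\to\mathbb R^m$ and $\mathcal M_1\subset\mathbb R^N$ put $c_{\rm opt}(A,\mathcal M_1)=\inf_\varphi\sup_{x\in\mathcal M_1}d^H(\varphi(Ax),\{x\})$, the infimum over all multivalued maps $\varphi$ from $A(\mathcal M_1)$ to $\mathbb R^N$, with $d^H$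 the Hausdorff distance. A single-valued map $\varphi$ is optimal for $(A,\mathcal M_1)$ if $\sup_{x\in\mathcal M_1}\|\varphi(Ax)-x\|\le c_{\rm opt}(A,\mathcal M_1)$. *Training sets.* Let $\Omega$ be a set of training sets, each consisting of exactly $\ell$ pairs $(x,Ax)$ with $\|x\|,\|Ax\|\le1$, and let every $\mathcal T\in\Omega$ have an initial domain $\mathcal M_1(\mathcal T)\subset\mathbb R^N$ that contains all $x$ with $(x,Ax)\in\mathcal T$. Put $U=\bigcup_{\mathcal T\in\Omega}A(\mathcal M_1(\mathcal T))$, let $\Xi(\mathcal T)\subset\mathcal{NN}_{m,N}$ be the set of networks that are optimal for $(A,\mathcal M_1(\mathcal T))$, and let $\Xi_D(\mathcal T)$ be the set of $C^\infty$ networks $\varphi\in\Xi(\mathcal T)$ with $\|\mathrm D\varphi(y)\|_{op}\le D$ for all $y\in A(\mathcal M_1(\mathcal T))$. A network $\varphi$ approximates an optimal network for $\mathcal T$ to accuracy $\varepsilon$ if $\mathrm{dist}(\varphi,\Xi(\mathcal T))=\inf_{\psi\in\Xi(\mathcal T)}d(\varphi,\psi)\le\varepsilon$. *Inexact input.* The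 measurements of $\mathcal T$ are the coordinates of its pairs $(x,y)$, the pairs being listed in lexicographic order. A representation $\tilde{\mathcal T}$ of $\mathcal T$ gives for every measurement $f$ and every $n\in\mathbb N$ a number $f_n\in2^{-n}\mathbb Z$ with $|f_n-f|\le2^{-n}$. *Algorithms.* A general algorithm assigns to every representation $\tilde{\mathcal T}$ of every $\mathcal T\in\Omega$ an element of $\mathcal{NN}_{m,N}$ or the value "does not halt", and a set of evaluations $f_n$ that it reads, which is finite if it halts, such that any two inputs that agree on the evaluations read for the first have the same output and the same set of evaluations read. A randomised general algorithm is a set $X$ of general algorithms with a $\sigma$-algebra and, for every input $\iota=\tilde{\mathcal T}$, a probability measure $\mathbb P_\iota$ on $X$, such that the output on $\iota$ is a random variable for the Borel $\sigma$-algebra (with "does not halt" as an isolated point), the event that all evaluations read on $\iota$ are among the first $n$ (in a fixed enumeration) is measurable for all $n$, and $\mathbb P_{\iota_1}(E)=\mathbb P_{\iota_2}(E)$ whenever $\iota_1,\iota_2$ agree on all evaluations that members of the event $E$ read on $\iota_1$. Not halting counts as infinite error. The strong probabilistic breakdown epsilon $\epsilon^{\rm s}_{\mathbb P\rm B}(p)$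 is the supremum of all $\varepsilon>0$ such that for every randomised general algorithm there is an input $\iota=\tilde{\mathcal T}$ on which the output has distance $>\varepsilon$ to $\Xi(\mathcal T)$ with $\mathbb P_\iota$-probability $>p$. **Theorem.** Let $N>m$ be integers, $\beta_{\max}\ge\beta_{\min}>0$, and let $A:\mathbb R^N\to\mathbb R^m$ be a non-zero linear map with $\mathrm{Sp}(AA^*)\subset[\beta_{\min}^2,\beta_{\max}^2]$. Let $\epsilon_1\in(0,3/8]$ be rational and $\ell\ge2$ an integer. Then there are a domain $\Omega$ of training sets of size $\ell$, initial domains $\mathcal M_1(\mathcal T)$ as above, and a $D\in\mathbb N$ with $\Xi_D(\mathcal T)\ne\emptyset$ for all $\mathcal T\in\Omega$, such that the following hold simultaneously. (i) $\epsilon^{\rm s}_{\mathbb P\rm B}(p)\ge\epsilon_1$ for all $p\in[0,1/2)$. Moreover, no general algorithm approximates an optimal network to accuracy $\epsilon_1$ on all inputs, and no randomised general algorithm (which may fail to halt) does so with probability $>1/2$ on every input. (ii) Let $K\in\mathbb N$, $\delta\in(0,\epsilon_1)$ and $\varepsilon\in(\epsilon_1,2\epsilon_1-\delta]$, and let $\Gamma$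 be any map (in particular, any algorithm in any model of computation) from the representations $\tilde{\mathcal T}$ of the $\mathcal T\in\Omega$ to $\mathcal{NN}_{m,N}$ that approximates an optimal network to accuracy $\varepsilon$ on all inputs. Then there are infinitely many $\mathcal T\in\Omega$ such that for every representation $\tilde{\mathcal T}$ of $\mathcal T$ the network $\mathbf N=\Gamma(\tilde{\mathcal T})$ has no Lipschitz constant smaller than $K$ and, if it is differentiable, satisfies $\|\mathrm D\mathbf N(c)\|_{op}\ge K$ for some $c\in\mathbb R^m$. (iii) There are an oracle Turing machine $\Gamma$ and a $K\in\mathbb N$ such that for every real $\varepsilon>2\epsilon_1$ and every $\mathcal T\in\Omega$ the machine, given oracle access to any representation of $\mathcal T$ and to any sequence of dyadic approximations of $\varepsilon$ (the $n$-th one in $2^{-n}\mathbb Z$ with error at most $2^{-n}$), halts and outputs a finite description, with rational weights, of a differentiable network in $\mathcal{NN}_{m,N}$ that approximates an optimal network for $\mathcal T$ to accuracy $\varepsilon$ and whose Jacobian has norm $\le K$ at every $c\in\mathbb R^m$. -/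

import Mathlib

/-- `ℝⁿ` with the `ℓ²` norm. -/
abbrev Euc (n : ℕ) : Type := EuclideanSpace ℝ (Fin n)

/-! ### Neural networks -/

/-- The hidden layers of a neural network with input dimension `m`, whose last hidden layer has
width `a`: an alternating composition of affine maps `x ↦ W x + b` and of activations which apply
the `j`-th nonlinearity (out of `s` fixed ones) to the coordinates in `I` and leave the other
coordinates unchanged. -/
inductive HiddenLayers (s m : ℕ) : ℕ → Type
  | input : HiddenLayers s m m
  | layer {a b : ℕ} (prev : HiddenLayers s m a) (W : Matrix (Fin b) (Fin a) ℂ) (bias : Fin b → ℂ)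
      (I : Finset (Fin b)) (j : Fin s) : HiddenLayers s m b

/-- The map computed by the hidden layers. -/
def HiddenLayers.eval {s m : ℕ} (σ : Fin s → ℂ → ℂ) :
    {a : ℕ} → HiddenLayers s m a → (Fin m → ℂ) → (Fin a → ℂ)
  | _, .input, y => y
  | _, .layer prev W bias I j, y => fun k =>
      let z := W.mulVec (prev.eval σ y) + bias
      if k ∈ I then σ j (z k) else z k

/-- A neural network `ℂᵐ → ℂᴺ`: hidden layers, followed by the affine map
`(x, y) ↦ W x + (R y + c)` of the last hidden vector `x` and of the input `y`. -/
structure NeuralNet (s m N : ℕ) where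
  width : ℕ
  hidden : HiddenLayers s m width
  W : Matrix (Fin N) (Fin width) ℂ
  R : Matrix (Fin N) (Fin m) ℂ
  c : Fin N → ℂ

/-- The map `ℂᵐ → ℂᴺ` computed by a neural network with nonlinearities `σ`. -/
def NeuralNet.eval {s m N : ℕ} (σ : Fin s → ℂ → ℂ) (net : NeuralNet s m N) (y : Fin m → ℂ) :
    Fin N → ℂ :=
  net.W.mulVec (net.hidden.eval σ y) + (net.R.mulVec y + net.c)

/-- The network has real values on real inputs, and its restriction to `ℝᵐ` is `φ`. -/
def NeuralNet.Realizes {s m N : ℕ} (σ : Fin s → ℂ → ℂ) (net : NeuralNet s m N)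
    (φ : Euc m → Euc N) : Prop :=
  ∀ (y : Euc m) (i : Fin N), net.eval σ (fun j => ((y j : ℝ) : ℂ)) i = ((φ y i : ℝ) : ℂ)

/-- The set of neural networks with nonlinearities `σ`, as maps `ℝᵐ → ℝᴺ`, that are
bounded on `U`. -/
def NNSpace {s : ℕ} (σ : Fin s → ℂ → ℂ) (N : ℕ) {m : ℕ} (U : Set (Euc m)) : Type :=
  {φ : Euc m → Euc N //
    (∃ net : NeuralNet s m N, net.Realizes σ φ) ∧ Bornology.IsBounded (φ '' U)}

/-- The distance of two networks is `d(φ, ψ) = sup_{y ∈ U} ‖φ y - ψ y‖`. -/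
noncomputable instance NNSpace.instPseudoEMetricSpace {s : ℕ} (σ : Fin s → ℂ → ℂ) (N : ℕ) {m : ℕ}
    (U : Set (Euc m)) : PseudoEMetricSpace (NNSpace σ N U) where
  edist φ ψ := ⨆ y ∈ U, edist (φ.1 y) (ψ.1 y)
  edist_self φ := by simp
  edist_comm φ ψ := by simp only [edist_comm]
  edist_triangle φ ψ χ := by
    refine iSup₂_le fun y hy => (edist_triangle _ (ψ.1 y) _).trans ?_
    exact add_le_add (le_iSup₂ (f := fun y (_ : y ∈ U) => edist (φ.1 y) (ψ.1 y)) y hy)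
      (le_iSup₂ (f := fun y (_ : y ∈ U) => edist (ψ.1 y) (χ.1 y)) y hy)

/-! ### Optimal maps in the sense of Cohen, Dahmen and DeVore -/

/-- The optimality constant `c_opt(A, M₁)`: the infimum over all multivalued maps `φ` of
`sup_{x ∈ M₁} d^H(φ(Ax), x)`, with `d^H` the Hausdorff distance. -/
noncomputable def optConst {N m : ℕ} (A : Euc N →L[ℝ] Euc m) (M₁ : Set (Euc N)) : ENNReal :=
  ⨅ φ : Euc m → Set (Euc N), ⨆ x ∈ M₁, Metric.hausdorffEDist (φ (A x)) {x}

/-- The (single-valued) map `φ` is optimal for `(A, M₁)`. -/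
def IsOptimalMap {N m : ℕ} (A : Euc N →L[ℝ] Euc m) (M₁ : Set (Euc N)) (φ : Euc m → Euc N) : Prop :=
  ⨆ x ∈ M₁, Metric.hausdorffEDist {φ (A x)} {x} ≤ optConst A M₁

/-! ### Training sets and the problem functions -/

/-- Training sets with exactly `ℓ` elements in the product of the closed unit balls. -/
def TrainingSet (N m ℓ : ℕ) : Type :=
  {T : Finset (Euc N × Euc m) // T.card = ℓ ∧ ∀ p ∈ T, ‖p.1‖ ≤ 1 ∧ ‖p.2‖ ≤ 1}

/-- Every `T ∈ Ω` consists of pairs `(x, A x)` with `x` in the initial domain `M₁ T` that belongs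
to `T`. -/
def IsTrainingDomain {N m ℓ : ℕ} (A : Euc N →L[ℝ] Euc m) (Ω : Set (TrainingSet N m ℓ))
    (M₁ : TrainingSet N m ℓ → Set (Euc N)) : Prop :=
  ∀ T ∈ Ω, ∀ p ∈ T.1, p.1 ∈ M₁ T ∧ p.2 = A p.1

/-- The union of the sets `A(M₁)` over all inverse problems `(A, M₁)` of the collection. -/
def measurementSet {N m ℓ : ℕ} (A : Euc N →L[ℝ] Euc m) (Ω : Set (TrainingSet N m ℓ))
    (M₁ : TrainingSet N m ℓ → Set (Euc N)) : Set (Euc m) :=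
  ⋃ T ∈ Ω, A '' M₁ T

/-- `Ξ(T)`: all neural networks that are optimal for `(A, M₁ T)`. -/
def optimalNNs {s N m ℓ : ℕ} (σ : Fin s → ℂ → ℂ) (A : Euc N →L[ℝ] Euc m)
    (Ω : Set (TrainingSet N m ℓ)) (M₁ : TrainingSet N m ℓ → Set (Euc N)) (T : TrainingSet N m ℓ) :
    Set (NNSpace σ N (measurementSet A Ω M₁)) :=
  {φ | IsOptimalMap A (M₁ T) φ.1}

/-- `Ξ_D(T)`: the smooth optimal networks whose Jacobian has operator norm at most `D` at every
point of `A(M₁ T)`. -/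
def optimalNNsD {s N m ℓ : ℕ} (σ : Fin s → ℂ → ℂ) (A : Euc N →L[ℝ] Euc m)
    (Ω : Set (TrainingSet N m ℓ)) (M₁ : TrainingSet N m ℓ → Set (Euc N)) (D : ℕ)
    (T : TrainingSet N m ℓ) : Set (NNSpace σ N (measurementSet A Ω M₁)) :=
  {φ ∈ optimalNNs σ A Ω M₁ T |
    ContDiff ℝ ((⊤ : ℕ∞) : WithTop ℕ∞) φ.1 ∧ ∀ y ∈ A '' M₁ T, ‖fderiv ℝ φ.1 y‖ ≤ D}

/-! ### Inexact input -/

/-- Pairs `(x, y)` as an ordered type with the lexicographic ordering of the coordinates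
`x₁, …, x_N, y₁, …, y_m`. -/
abbrev LexPair (N m : ℕ) : Type := Lex (Fin N → ℝ) ×ₗ Lex (Fin m → ℝ)

/-- The identification of `ℝᴺ × ℝᵐ` with the lexicographically ordered space. -/
def lexKey (N m : ℕ) : Euc N × Euc m ≃ LexPair N m :=
  (((WithLp.equiv 2 (Fin N → ℝ)).trans toLex).prodCongr
    ((WithLp.equiv 2 (Fin m → ℝ)).trans toLex)).trans toLex

/-- The `k`-th element of a training set in the lexicographic ordering. -/
noncomputable def TrainingSet.nth {N m ℓ : ℕ} (T : TrainingSet N m ℓ) (k : Fin ℓ) : Euc N × Euc m :=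
  (lexKey N m).symm
    ((T.1.map (lexKey N m).toEmbedding).orderEmbOfFin ((T.1.card_map _).trans T.2.1) k)

/-- Indices of the measurements: `(k, inl i)` is the `i`-th coordinate of `x`, and `(k, inr j)`
the `j`-th coordinate of `y`, for the `k`-th pair `(x, y)` of the training set. -/
abbrev MeasIdx (N m ℓ : ℕ) : Type := Fin ℓ × (Fin N ⊕ Fin m)

/-- The exact measurements of a training set. -/
noncomputable def TrainingSet.meas {N m ℓ : ℕ} (T : TrainingSet N m ℓ) : MeasIdx N m ℓ → ℝ
  | (k, .inl i) => (T.nth k).1 i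
  | (k, .inr j) => (T.nth k).2 j

/-- `g` is a sequence of dyadic approximations of the real number `x`: the `n`-th one is
`g n / 2ⁿ`, with error at most `2⁻ⁿ`. -/
def DyadicApprox (g : ℕ → ℤ) (x : ℝ) : Prop :=
  ∀ n : ℕ, |(g n : ℝ) / 2 ^ n - x| ≤ 1 / 2 ^ n

/-- The inputs with `Δ₁`-information: a training set of `Ω` with dyadic approximations of all its
measurements (which determine the training set). Algorithms only read the approximations. -/
def InexactInput {N m ℓ : ℕ} (Ω : Set (TrainingSet N m ℓ)) : Type :=
  {ι : TrainingSet N m ℓ × (MeasIdx N m ℓ → ℕ → ℤ) //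
    ι.1 ∈ Ω ∧ ∀ i, DyadicApprox (ι.2 i) (ι.1.meas i)}

/-- The evaluations of an inexact input: its dyadic approximations. -/
noncomputable def inexactEval {N m ℓ : ℕ} (Ω : Set (TrainingSet N m ℓ)) (q : MeasIdx N m ℓ × ℕ)
    (ι : InexactInput Ω) : ℝ :=
  (ι.1.2 q.1 q.2 : ℝ) / 2 ^ q.2

/-- `Ξ` as a function of the inexact input. -/
def inexactOptimalNNs {s N m ℓ : ℕ} (σ : Fin s → ℂ → ℂ) (A : Euc N →L[ℝ] Euc m)
    (Ω : Set (TrainingSet N m ℓ)) (M₁ : TrainingSet N m ℓ → Set (Euc N)) (ι : InexactInput Ω) :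
    Set (NNSpace σ N (measurementSet A Ω M₁)) :=
  optimalNNs σ A Ω M₁ ι.1.1

/-! ### General algorithms, randomised general algorithms, breakdown epsilons -/

/-- A general algorithm on the domain `In` with evaluations `ev`. The output is a point of `M`, or
`Sum.inr ()` if the algorithm does not halt; only finitely many evaluations are read when it
halts, and both the output and the set of evaluations read are determined by the values read. -/
structure GeneralAlgorithm {In Ix : Type} (ev : Ix → In → ℝ) (M : Type) where
  out : In → M ⊕ Unit
  evals : In → Set Ix
  finite_evals : ∀ ι, out ι ≠ Sum.inr () → (evals ι).Finite
  out_eq : ∀ ι ι', (∀ f ∈ evals ι, ev f ι' = ev f ι) → out ι' = out ι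
  evals_eq : ∀ ι ι', (∀ f ∈ evals ι, ev f ι' = ev f ι) → evals ι' = evals ι

/-- A randomised general algorithm: a collection `X` of general algorithms with a sigma-algebra and
a probability measure for each input. The sigma-algebra on the outputs is the Borel one. -/
structure RandomisedGeneralAlgorithm {In Ix : Type} [Encodable Ix] (ev : Ix → In → ℝ) (M : Type)
    [PseudoEMetricSpace M] where
  X : Set (GeneralAlgorithm ev M)
  𝓕 : MeasurableSpace X
  P : In → @MeasureTheory.Measure X 𝓕
  prob : ∀ ι, MeasureTheory.IsProbabilityMeasure (P ι)
  measurable_out : ∀ ι, @Measurable X (M ⊕ Unit) 𝓕 (borel (M ⊕ Unit)) fun Γ => Γ.1.out ι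
  /-- the runtime, that is the largest index of an evaluation read, is measurable -/
  measurable_runtime : ∀ (n : ℕ) (ι : In),
    @MeasurableSet X 𝓕 {Γ | ∀ f ∈ Γ.1.evals ι, Encodable.encode f ≤ n}
  consistent : ∀ (ι₁ ι₂ : In) (S : Set X), @MeasurableSet X 𝓕 S →
    (∀ Γ ∈ S, ∀ f ∈ Γ.1.evals ι₁, ev f ι₁ = ev f ι₂) → P ι₁ S = P ι₂ S

/-- The distance of an output to a set of solutions; it is infinite for "not halting". -/
noncomputable def outputError {M : Type} [PseudoEMetricSpace M] (S : Set M) : M ⊕ Unit → ENNReal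
  | .inl x => Metric.infEDist x S
  | .inr _ => ⊤

/-- The strong probabilistic breakdown epsilon at level `p`. -/
noncomputable def strongProbBreakdown {In Ix : Type} [Encodable Ix] (ev : Ix → In → ℝ) {M : Type}
    [PseudoEMetricSpace M] (Ξ : In → Set M) (p : ℝ) : ENNReal :=
  sSup {ε : ENNReal | 0 < ε ∧ ∀ R : RandomisedGeneralAlgorithm ev M, ∃ ι : In,
    ENNReal.ofReal p < R.P ι {Γ | ε < outputError (Ξ ι) (Γ.1.out ι)}}

/-! ### Turing computability with an oracle -/

/-- Programs for partial recursive functions relative to an oracle `ℕ → ℕ`. One program serves all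
oracles. -/
inductive OracleProgram : Type
  | zero : OracleProgram
  | succ : OracleProgram
  | left : OracleProgram
  | right : OracleProgram
  | oracle : OracleProgram
  | pair : OracleProgram → OracleProgram → OracleProgram
  | comp : OracleProgram → OracleProgram → OracleProgram
  | prec : OracleProgram → OracleProgram → OracleProgram
  | rfind : OracleProgram → OracleProgram

/-- The partial function computed by a program with oracle `g`. -/
def OracleProgram.eval (g : ℕ → ℕ) : OracleProgram → ℕ →. ℕ
  | zero => fun _ => Part.some 0
  | succ => fun n => Part.some (n + 1)
  | left => fun n => Part.some n.unpair.1
  | right => fun n => Part.some n.unpair.2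
  | oracle => fun n => Part.some (g n)
  | pair c d => fun n => Nat.pair <$> c.eval g n <*> d.eval g n
  | comp c d => fun n => d.eval g n >>= c.eval g
  | prec c d => fun p =>
      Nat.rec (c.eval g p.unpair.1)
        (fun y IH => IH >>= fun i => d.eval g (Nat.pair p.unpair.1 (Nat.pair y i))) p.unpair.2
  | rfind c => fun a => Nat.rfind fun n => (fun k => decide (k = 0)) <$> c.eval g (Nat.pair a n)

/-- The oracle that answers queries for the `n`-th approximation of a measurement, and queries for
the `n`-th approximation of the accuracy parameter. Queries and answers are coded by natural
numbers. -/
def inputOracle {N m ℓ : ℕ} (g : MeasIdx N m ℓ → ℕ → ℤ) (e : ℕ → ℤ) (q : ℕ) : ℕ :=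
  match Encodable.decode (α := (MeasIdx N m ℓ × ℕ) ⊕ ℕ) q with
  | some (.inl (i, n)) => Encodable.encode (g i n)
  | some (.inr n) => Encodable.encode (e n)
  | none => 0

/-- Finite description of a hidden layer with rational weights: width, rows of the matrix, bias,
list of the coordinates to which the nonlinearity applies, label of the nonlinearity. -/
abbrev LayerCode (s : ℕ) : Type := ℕ × List (List ℚ) × List ℚ × List ℕ × Fin s

/-- Finite description of a network with rational weights: the hidden layers from first to last,
and the data `W`, `R`, `c` of the last affine map. -/
abbrev NetCode (s : ℕ) : Type :=
  List (LayerCode s) × List (List ℚ) × List (List ℚ) × List ℚ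

/-- The vector with given entries (missing entries are `0`, superfluous ones are ignored). -/
def vecOfList {a : ℕ} (v : List ℚ) : Fin a → ℂ := fun i => ((v.getD i 0 : ℚ) : ℂ)

/-- The matrix with given rows (missing entries are `0`, superfluous ones are ignored). -/
def matOfLists {a b : ℕ} (W : List (List ℚ)) : Matrix (Fin b) (Fin a) ℂ :=
  Matrix.of fun i => vecOfList (W.getD i [])

/-- The hidden layers described by a list of layer descriptions. -/
def hiddenOfCode {s m : ℕ} (L : List (LayerCode s)) : Σ a : ℕ, HiddenLayers s m a :=
  L.foldl (fun h c => ⟨c.1, .layer h.2 (matOfLists c.2.1) (vecOfList c.2.2.1)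
    (Finset.univ.filter fun k => (k : ℕ) ∈ c.2.2.2.1) c.2.2.2.2⟩) ⟨m, .input⟩

/-- The network described by a finite description. -/
def NetCode.toNet {s : ℕ} (m N : ℕ) (d : NetCode s) : NeuralNet s m N where
  width := (hiddenOfCode (m := m) d.1).1
  hidden := (hiddenOfCode (m := m) d.1).2
  W := matOfLists d.2.1
  R := matOfLists d.2.2.1
  c := vecOfList d.2.2.2

/-! The obstruction is a one-parameter family of inverse problems. Fix a unit vector `v` in the
kernel of `A` and a vector `w` outside of it, with all data in the ball of radius `a = 2 ε₁`. The
training set with parameter `t ∈ [0, 1/2]` consists of multiples of `w`, shifted by `t • w`, so it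
depends continuously on `t`. The initial domain has two further points which the training set does
not show. Over the measurement `0` lies `-a v` if `t = 0` and `a v` if `t > 0`; for `t > 0` another
point close to `-a v` lies over `t • A w`. Since `A` is injective on each of these finite domains,
the optimality constant is `0`, and optimal networks are exactly the interpolating ones.

Breakdown: the prescribed values at `0` for `t = 0` and `t > 0` are `2a` apart, so no network is
within `ε₁ < a` of both solution sets, while finitely many dyadic approximations cannot separate `t
= 0` from all small `t > 0` (`KernelPair.indistinguishableAt`). For randomised algorithms, success
with probability above `1/2` at `t = 0` is carried over to failure at a nearby `t` by consistency
and continuity of measure.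

Instability: for small `t > 0`, a map within `a - δ` of an optimal network has values at `0` and `t
• A w` that differ by at least `δ`, over a distance of at most `t`
(`KernelPair.le_dist_of_infEDist_le`).

Stability above `a`: there are optimal networks with values of norm at most `(1 + η) a` on all
measurements, so the zero network has every accuracy above `a`, and a constant program suffices.
This needs interpolating networks with almost minimal sup norm. They come from the density, in the
`C¹` sense on an interval, of linear combinations of the functions `t ↦ f (l t + c)`, corrected so
that values and derivatives at finitely many nodes are exact (`exists_dual_dilateSpan`). -/

/-! ### Density of the dilated translates of a smooth non-polynomial function. -/

/-- The derivative in the parameter of a curve of continuous functions that stays in a closed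
subspace lies in that subspace. -/
theorem mem_of_hasDerivAt_param {X : Type*} [TopologicalSpace X] [CompactSpace X]
    (M : Submodule ℝ C(X, ℝ)) (hM : IsClosed (M : Set C(X, ℝ)))
    (G : ℝ → C(X, ℝ)) (G' : ℝ → X → ℝ) (hG' : Continuous fun q : ℝ × X => G' q.1 q.2)
    (hd : ∀ l x, HasDerivAt (fun l => G l x) (G' l x) l) (hmem : ∀ l, G l ∈ M)
    (l : ℝ) (F : C(X, ℝ)) (hF : ∀ x, F x = G' l x) : F ∈ M := by
  -- Joint continuity makes `l ↦ G' l` a continuous curve in the sup norm, so its integral is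
  -- differentiable in norm. As the integral equals `G r - G l`, pointwise derivatives become norm
  -- derivatives.
  set g : C(ℝ, C(X, ℝ)) := ContinuousMap.curry ⟨fun q : ℝ × X => G' q.1 q.2, hG'⟩
  have hFg : F = g l := by ext x; exact hF x
  have hint : ∀ r, IntervalIntegrable g MeasureTheory.volume l r :=
    fun r => g.continuous.intervalIntegrable _ _
  have hder : HasDerivAt (fun r => ∫ s in l..r, g s) (g l) l :=
    intervalIntegral.integral_hasDerivAt_right (hint l)
      g.continuous.stronglyMeasurable.stronglyMeasurableAtFilter g.continuous.continuousAt
  have hval : ∀ r, ∫ s in l..r, g s = G r - G l := by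
    intro r
    ext x
    have h1 := (ContinuousMap.evalCLM ℝ (M := ℝ) x).intervalIntegral_comp_comm (hint r)
    have h2 : ∫ s in l..r, G' s x = G r x - G l x :=
      intervalIntegral.integral_eq_sub_of_hasDerivAt (fun s _ => hd s x)
        ((hG'.comp (continuous_id.prodMk continuous_const)).intervalIntegrable _ _)
    exact h1.symm.trans h2
  rw [hFg]
  -- The difference quotients lie in `M`, and `M` is closed.
  refine hM.mem_of_tendsto (hasDerivAt_iff_tendsto_slope.1 hder)
    (Filter.Eventually.of_forall fun r => ?_)
  rw [slope_def_module, hval, hval]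
  exact M.smul_mem _ (M.sub_mem (M.sub_mem (hmem _) (hmem _)) (M.sub_mem (hmem _) (hmem _)))

theorem Polynomial.exists_derivative_eq (p : Polynomial ℝ) :
    ∃ q : Polynomial ℝ, Polynomial.derivative q = p := by
  induction p using Polynomial.induction_on' with
  | add p q hp hq =>
    obtain ⟨P, rfl⟩ := hp
    obtain ⟨Q, rfl⟩ := hq
    exact ⟨P + Q, by simp⟩
  | monomial n a =>
    refine ⟨Polynomial.monomial (n + 1) (a / (n + 1)), ?_⟩
    rw [Polynomial.derivative_monomial, Nat.add_sub_cancel]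
    congr 1
    push_cast
    field_simp

theorem exists_polynomial_of_deriv_eq_polynomial {g : ℝ → ℝ} (hg : Differentiable ℝ g)
    {p : Polynomial ℝ} (hp : ∀ t, deriv g t = p.eval t) :
    ∃ q : Polynomial ℝ, ∀ t, g t = q.eval t := by
  obtain ⟨P, rfl⟩ := p.exists_derivative_eq
  have hc : ∀ t, g t - P.eval t = g 0 - P.eval 0 := fun t =>
    is_const_of_deriv_eq_zero (f := fun t => g t - P.eval t) (hg.sub P.differentiable)
      (fun t => by
        rw [deriv_fun_sub (hg t) P.differentiableAt, hp, Polynomial.deriv, sub_self]) t 0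
  refine ⟨P + Polynomial.C (g 0 - P.eval 0), fun t => ?_⟩
  rw [Polynomial.eval_add, Polynomial.eval_C, ← hc t]
  ring

theorem exists_polynomial_of_iterate_deriv_eq_zero (k : ℕ) :
    ∀ g : ℝ → ℝ, ContDiff ℝ ((⊤ : ℕ∞) : WithTop ℕ∞) g → (∀ t, deriv^[k] g t = 0) →
      ∃ p : Polynomial ℝ, ∀ t, g t = p.eval t := by
  induction k with
  | zero => intro g _ h; exact ⟨0, fun t => by simpa using h t⟩
  | succ k ih =>
    intro g hg h
    obtain ⟨p, hp⟩ := ih (deriv g) (contDiff_infty_iff_deriv.1 hg).2 h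
    exact exists_polynomial_of_deriv_eq_polynomial (contDiff_infty_iff_deriv.1 hg).1 hp

/-- A closed subspace of `C([a, b])` that contains all dilated translates of a smooth function that
is not a polynomial is everything. -/
theorem eq_top_of_forall_dilate_mem {a b : ℝ} {p : ℝ → ℝ}
    (hp : ContDiff ℝ ((⊤ : ℕ∞) : WithTop ℕ∞) p) (hnp : ¬ ∃ q : Polynomial ℝ, ∀ t, p t = q.eval t)
    (M : Submodule ℝ C(Set.Icc a b, ℝ)) (hM : IsClosed (M : Set C(Set.Icc a b, ℝ)))
    (h : ∀ (l c : ℝ) (F : C(Set.Icc a b, ℝ)), (∀ t, F t = p (l * t + c)) → F ∈ M) : M = ⊤ := by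
  have hk : ∀ k, ContDiff ℝ ((⊤ : ℕ∞) : WithTop ℕ∞) (deriv^[k] p) := fun k => hp.iterate_deriv k
  -- Differentiation of `t ^ k * p⁽ᵏ⁾ (l t + c)` in `l` produces one more factor `t` and one more
  -- derivative of `p`.
  have key : ∀ (k : ℕ) (l c : ℝ) (F : C(Set.Icc a b, ℝ)),
      (∀ t, F t = (t : ℝ) ^ k * deriv^[k] p (l * t + c)) → F ∈ M := by
    intro k
    induction k with
    | zero => intro l c F hF; exact h l c F fun t => by simpa using hF t
    | succ k ih =>
      intro l c F hF
      have hc := (hk k).continuous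
      have hc' := (hk (k + 1)).continuous
      refine mem_of_hasDerivAt_param M hM
        (fun l => ⟨fun t => (t : ℝ) ^ k * deriv^[k] p (l * t + c), by fun_prop⟩)
        (fun l t => (t : ℝ) ^ (k + 1) * deriv^[k + 1] p (l * t + c)) (by fun_prop)
        (fun l t => ?_) (fun l => ih l c _ fun t => rfl) l F hF
      have h1 : HasDerivAt (deriv^[k] p) (deriv^[k + 1] p (l * t + c)) (l * t + c) := by
        rw [Function.iterate_succ_apply']
        exact ((contDiff_infty_iff_deriv.1 (hk k)).1 _).hasDerivAt
      have h2 : HasDerivAt (fun l : ℝ => l * (t : ℝ) + c) (t : ℝ) l := by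
        simpa using ((hasDerivAt_id l).mul_const (t : ℝ)).add_const c
      have h3 := (HasDerivAt.comp l h1 h2).const_mul ((t : ℝ) ^ k)
      refine h3.congr_deriv ?_
      ring
  have hmon : ∀ k : ℕ, ∀ F : C(Set.Icc a b, ℝ), (∀ t, F t = (t : ℝ) ^ k) → F ∈ M := by
    intro k F hF
    -- At `l = 0` the function is a multiple of `t ^ k`. The factor can be chosen non-zero because
    -- `p` is not a polynomial. Weierstrass' theorem then finishes the proof.
    obtain ⟨c, hc⟩ : ∃ c, deriv^[k] p c ≠ 0 := by
      by_contra! hcon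
      exact hnp (exists_polynomial_of_iterate_deriv_eq_zero k p hp hcon)
    have h1 : (deriv^[k] p c) • F ∈ M := key k 0 c _ fun t => by
      simp [hF, mul_comm]
    have h2 := M.smul_mem (deriv^[k] p c)⁻¹ h1
    rwa [smul_smul, inv_mul_cancel₀ hc, one_smul] at h2
  have hpoly : ∀ q : Polynomial ℝ, Polynomial.toContinuousMapOn q (Set.Icc a b) ∈ M := by
    intro q
    have : Polynomial.toContinuousMapOn q (Set.Icc a b) = ∑ i ∈ Finset.range (q.natDegree + 1),
        q.coeff i • Polynomial.toContinuousMapOn (Polynomial.X ^ i) (Set.Icc a b) := by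
      ext t
      simp [Polynomial.eval_eq_sum_range, ContinuousMap.sum_apply]
    rw [this]
    exact M.sum_mem fun i _ => M.smul_mem _ (hmon i _ fun t => by simp)
  rw [eq_top_iff]
  intro F _
  have hF : F ∈ (polynomialFunctions (Set.Icc a b)).topologicalClosure := by
    rw [polynomialFunctions_closure_eq_top]; trivial
  rw [← SetLike.mem_coe, Subalgebra.topologicalClosure_coe, polynomialFunctions_coe] at hF
  refine closure_minimal ?_ hM hF
  rintro _ ⟨q, rfl⟩
  exact hpoly q

/-! ### Approximation of values and derivatives with exact interpolation. -/

/-- Approximation from a subspace is possible with exact values of finitely many continuous linear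
functionals. -/
theorem Submodule.exists_approx_map_eq {E F : Type*} [NormedAddCommGroup E] [NormedSpace ℝ E]
    [NormedAddCommGroup F] [NormedSpace ℝ F] [FiniteDimensional ℝ F] (M : Submodule ℝ E)
    (Λ : E →L[ℝ] F) {x : E} (hx : x ∈ closure (M : Set E)) {η : ℝ} (hη : 0 < η) :
    ∃ y ∈ M, ‖y - x‖ < η ∧ Λ y = Λ x := by
  set Λ' : M →ₗ[ℝ] M.map (Λ : E →ₗ[ℝ] F) := (Λ : E →ₗ[ℝ] F).submoduleMap M
  obtain ⟨R, hR⟩ := Λ'.exists_rightInverse_of_surjective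
    (LinearMap.range_eq_top.2 ((Λ : E →ₗ[ℝ] F).submoduleMap_surjective M))
  -- The image of `M` is finite-dimensional, hence closed, so it contains `Λ x`.
  have hΛx : Λ x ∈ M.map (Λ : E →ₗ[ℝ] F) := by
    have hcl : IsClosed (M.map (Λ : E →ₗ[ℝ] F) : Set F) := Submodule.closed_of_finiteDimensional _
    have := image_closure_subset_closure_image Λ.continuous (Set.mem_image_of_mem Λ hx)
    rw [← SetLike.mem_coe, ← hcl.closure_eq]
    exact this
  -- The defect of an approximant tends to `0`. Adding its image under a right inverse of `Λ'`,
  -- which is continuous by finite dimension, makes the functionals exact at a vanishing cost.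
  let d : M → M.map (Λ : E →ₗ[ℝ] F) := fun y => ⟨Λ x, hΛx⟩ - Λ' y
  let R' := LinearMap.toContinuousLinearMap (R : M.map (Λ : E →ₗ[ℝ] F) →ₗ[ℝ] M)
  obtain ⟨u, hu, hux⟩ := mem_closure_iff_seq_limit.1 hx
  have hd : Filter.Tendsto (fun n => d ⟨u n, hu n⟩) Filter.atTop (nhds 0) := by
    rw [tendsto_subtype_rng]
    have : Filter.Tendsto (fun n => Λ x - Λ (u n)) Filter.atTop (nhds (Λ x - Λ x)) :=
      tendsto_const_nhds.sub ((Λ.continuous.tendsto x).comp hux)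
    rw [sub_self] at this
    exact this
  have hlim : Filter.Tendsto (fun n => (u n + (R' (d ⟨u n, hu n⟩) : E))) Filter.atTop
      (nhds (x + (R' 0 : M))) :=
    hux.add ((continuous_subtype_val.comp R'.continuous).continuousAt.tendsto.comp hd)
  rw [map_zero, Submodule.coe_zero, add_zero] at hlim
  obtain ⟨n, hn⟩ := (hlim.eventually (Metric.ball_mem_nhds x hη)).exists
  refine ⟨u n + (R' (d ⟨u n, hu n⟩) : E), M.add_mem (hu n) (R' _).2, ?_, ?_⟩
  · rwa [← dist_eq_norm]
  · have h1 : Λ' (R (d ⟨u n, hu n⟩)) = d ⟨u n, hu n⟩ := LinearMap.congr_fun hR _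
    have h2 : Λ ((R (d ⟨u n, hu n⟩) : M) : E) = Λ x - Λ (u n) := congrArg Subtype.val h1
    rw [map_add]
    change Λ (u n) + Λ ((R (d ⟨u n, hu n⟩) : M) : E) = Λ x
    rw [h2]; abel

/-- The space of all finite linear combinations of the functions `t ↦ f (l t + c)`. -/
def dilateSpan (f : ℝ → ℝ) : Submodule ℝ (ℝ → ℝ) :=
  Submodule.span ℝ (Set.range fun (q : ℝ × ℝ) (t : ℝ) => f (q.1 * t + q.2))

theorem dilate_mem_dilateSpan (f : ℝ → ℝ) (l c : ℝ) :
    (fun t => f (l * t + c)) ∈ dilateSpan f :=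
  Submodule.subset_span ⟨(l, c), rfl⟩

theorem contDiff_of_mem_dilateSpan {f : ℝ → ℝ} (hf : ContDiff ℝ ((⊤ : ℕ∞) : WithTop ℕ∞) f)
    {g : ℝ → ℝ} (hg : g ∈ dilateSpan f) : ContDiff ℝ ((⊤ : ℕ∞) : WithTop ℕ∞) g := by
  induction hg using Submodule.span_induction with
  | mem g hg =>
    obtain ⟨q, rfl⟩ := hg
    exact hf.comp ((contDiff_const.mul contDiff_id).add contDiff_const)
  | zero => exact contDiff_const
  | add g h _ _ hg hh => exact hg.add hh
  | smul a g _ hg => exact contDiff_const.mul hg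

theorem differentiable_of_mem_dilateSpan {f : ℝ → ℝ}
    (hf : ContDiff ℝ ((⊤ : ℕ∞) : WithTop ℕ∞) f) {g : ℝ → ℝ} (hg : g ∈ dilateSpan f) :
    Differentiable ℝ g :=
  (contDiff_of_mem_dilateSpan hf hg).differentiable (by simp)

theorem const_mem_dilateSpan {f : ℝ → ℝ} (hnp : ¬ ∃ q : Polynomial ℝ, ∀ t, f t = q.eval t)
    (a : ℝ) : (fun _ => a) ∈ dilateSpan f := by
  obtain ⟨c, hc⟩ : ∃ c, f c ≠ 0 := by
    by_contra! hcon
    exact hnp ⟨0, by simpa using hcon⟩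
  have := (dilateSpan f).smul_mem (a / f c) (dilate_mem_dilateSpan f 0 c)
  convert this using 1
  funext t
  simp [hc]

/-- The restrictions to `X` of the derivatives of the functions in `dilateSpan f`. -/
def derivDilateSpan {f : ℝ → ℝ} (hf : ContDiff ℝ ((⊤ : ℕ∞) : WithTop ℕ∞) f) (X : Set ℝ) :
    Submodule ℝ C(X, ℝ) where
  carrier := {F | ∃ g ∈ dilateSpan f, ∀ t : X, F t = deriv g t}
  zero_mem' := ⟨0, Submodule.zero_mem _, fun t => by simp⟩
  add_mem' := by
    rintro F G ⟨g, hg, hF⟩ ⟨h, hh, hG⟩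
    refine ⟨g + h, Submodule.add_mem _ hg hh, fun t => ?_⟩
    rw [deriv_add (differentiable_of_mem_dilateSpan hf hg _)
      (differentiable_of_mem_dilateSpan hf hh _), ContinuousMap.add_apply, hF, hG]
  smul_mem' := by
    rintro a F ⟨g, hg, hF⟩
    refine ⟨a • g, Submodule.smul_mem _ a hg, fun t => ?_⟩
    rw [deriv_const_smul _ (differentiable_of_mem_dilateSpan hf hg _), ContinuousMap.smul_apply, hF]

/-- The derivative of `t ↦ f (l t + c)` is `l * f' (l t + c)`, so the density theorem applies to
`f'`, which is no polynomial because `f` is none. -/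
theorem topologicalClosure_derivDilateSpan {f : ℝ → ℝ}
    (hf : ContDiff ℝ ((⊤ : ℕ∞) : WithTop ℕ∞) f)
    (hnp : ¬ ∃ q : Polynomial ℝ, ∀ t, f t = q.eval t) (a b : ℝ) :
    (derivDilateSpan hf (Set.Icc a b)).topologicalClosure = ⊤ := by
  set M := (derivDilateSpan hf (Set.Icc a b)).topologicalClosure
  have hM : IsClosed (M : Set C(Set.Icc a b, ℝ)) := Submodule.isClosed_topologicalClosure _
  have hf1 : ContDiff ℝ ((⊤ : ℕ∞) : WithTop ℕ∞) (deriv f) := (contDiff_infty_iff_deriv.1 hf).2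
  have hf2 : ContDiff ℝ ((⊤ : ℕ∞) : WithTop ℕ∞) (deriv (deriv f)) :=
    (contDiff_infty_iff_deriv.1 hf1).2
  have hfd : Differentiable ℝ f := (contDiff_infty_iff_deriv.1 hf).1
  have hc1 := hf1.continuous
  have hc2 := hf2.continuous
  have hmul : ∀ (l c : ℝ) (F : C(Set.Icc a b, ℝ)),
      (∀ t, F t = l * deriv f (l * t + c)) → F ∈ M := by
    intro l c F hF
    refine Submodule.le_topologicalClosure _ ⟨_, dilate_mem_dilateSpan f l c, fun t => ?_⟩
    have h2 : HasDerivAt (fun t : ℝ => l * t + c) l (t : ℝ) := by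
      simpa using ((hasDerivAt_id (t : ℝ)).const_mul l).add_const c
    rw [hF, mul_comm]
    exact (HasDerivAt.comp (t : ℝ) (hfd _).hasDerivAt h2).deriv.symm
  refine eq_top_of_forall_dilate_mem hf1
    (fun ⟨q, hq⟩ => hnp (exists_polynomial_of_deriv_eq_polynomial hfd hq)) M hM fun l c F hF => ?_
  rcases eq_or_ne l 0 with rfl | hl
  -- Division by `l` is impossible here. The constant `f' c` is instead the derivative of `l ↦ l *
  -- f' (l t + c)` at `l = 0`.
  · refine mem_of_hasDerivAt_param M hM
      (fun l => ⟨fun t => l * deriv f (l * t + c), by fun_prop⟩)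
      (fun l t => deriv f (l * t + c) + l * (deriv (deriv f) (l * t + c) * t)) (by fun_prop)
      (fun l t => ?_) (fun l => hmul l c _ fun t => rfl) 0 F (fun t => by simp [hF])
    have h1 : HasDerivAt (deriv f) (deriv (deriv f) (l * t + c)) (l * t + c) :=
      ((contDiff_infty_iff_deriv.1 hf1).1 _).hasDerivAt
    have h2 : HasDerivAt (fun l : ℝ => l * (t : ℝ) + c) (t : ℝ) l := by
      simpa using ((hasDerivAt_id l).mul_const (t : ℝ)).add_const c
    have h3 := (hasDerivAt_id l).mul (HasDerivAt.comp l h1 h2)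
    refine h3.congr_deriv ?_
    simp
  · have h1 : l • F ∈ M := hmul l c _ fun t => by simp [hF]
    have h2 := M.smul_mem l⁻¹ h1
    rwa [smul_smul, inv_mul_cancel₀ hl, one_smul] at h2

/-- Approximation on `[a, b]` of a `C¹` function by linear combinations of dilated translates of
a smooth function that is not a polynomial, with exact values and derivatives at finitely many
points. -/
theorem exists_mem_dilateSpan_approx {f : ℝ → ℝ} (hf : ContDiff ℝ ((⊤ : ℕ∞) : WithTop ℕ∞) f)
    (hnp : ¬ ∃ q : Polynomial ℝ, ∀ t, f t = q.eval t) {a b : ℝ} (hab : a ≤ b)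
    {h : ℝ → ℝ} (hh : ContDiff ℝ 1 h) (Y : Finset (Set.Icc a b)) {η : ℝ} (hη : 0 < η) :
    ∃ g ∈ dilateSpan f, (∀ t ∈ Set.Icc a b, |g t - h t| ≤ η) ∧
      ∀ y ∈ Y, g y = h y ∧ deriv g y = deriv h y := by
  have hhd : Differentiable ℝ h := hh.differentiable one_ne_zero
  have hhc := hh.continuous_deriv_one
  let M : Submodule ℝ (C(Set.Icc a b, ℝ) × C(Set.Icc a b, ℝ)) :=
    { carrier := {F | ∃ g ∈ dilateSpan f, ∀ t : Set.Icc a b, F.1 t = g t ∧ F.2 t = deriv g t}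
      zero_mem' := ⟨0, Submodule.zero_mem _, fun t => by simp⟩
      add_mem' := by
        rintro F G ⟨g, hg, hF⟩ ⟨h, hh, hG⟩
        refine ⟨g + h, Submodule.add_mem _ hg hh, fun t => ?_⟩
        rw [deriv_add (differentiable_of_mem_dilateSpan hf hg _)
          (differentiable_of_mem_dilateSpan hf hh _)]
        simp [hF, hG]
      smul_mem' := by
        rintro c F ⟨g, hg, hF⟩
        refine ⟨c • g, Submodule.smul_mem _ c hg, fun t => ?_⟩
        rw [deriv_const_smul _ (differentiable_of_mem_dilateSpan hf hg _)]
        simp [hF] }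
  let x : C(Set.Icc a b, ℝ) × C(Set.Icc a b, ℝ) :=
    (⟨fun t => h t, by have := hhd.continuous; fun_prop⟩, ⟨fun t => deriv h t, by fun_prop⟩)
  have hx : x ∈ closure (M : Set (C(Set.Icc a b, ℝ) × C(Set.Icc a b, ℝ))) := by
    rw [Metric.mem_closure_iff]
    intro r hr
    -- If the derivatives are `r'`-close and the values agree at `a`, then the values are `r' * (b -
    -- a)`-close. The sum of both errors stays below `r`.
    set r' : ℝ := r / (2 * (1 + (b - a)))
    have hba : 0 ≤ b - a := sub_nonneg.2 hab
    have hr' : 0 < r' := by positivity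
    have hrr : r' * (1 + (b - a)) < r := by
      have : r' * (1 + (b - a)) = r / 2 := by simp only [r']; field_simp
      linarith
    have hmem : x.2 ∈ (derivDilateSpan hf (Set.Icc a b)).topologicalClosure := by
      rw [topologicalClosure_derivDilateSpan hf hnp]; trivial
    obtain ⟨F, ⟨g, hg, hF⟩, hdist⟩ := Metric.mem_closure_iff.1 hmem r' hr'
    have hg1 : (g + fun _ => h a - g a) ∈ dilateSpan f :=
      Submodule.add_mem _ hg (const_mem_dilateSpan hnp _)
    have hgd := differentiable_of_mem_dilateSpan hf hg
    have hgc : Continuous g := hgd.continuous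
    have hder : ∀ t ∈ Set.Icc a b, ‖deriv g t - deriv h t‖ ≤ r' := by
      intro t ht
      have h1 := (ContinuousMap.dist_apply_le_dist (f := F) (g := x.2) ⟨t, ht⟩).trans
        ((dist_comm _ _).trans_le hdist.le)
      rw [hF ⟨t, ht⟩] at h1
      exact h1
    have hval : ∀ t ∈ Set.Icc a b, ‖g t + (h a - g a) - h t‖ ≤ r' * (b - a) := by
      intro t ht
      have h1 := (convex_Icc a b).norm_image_sub_le_of_norm_hasDerivWithin_le
        (f := fun t => g t - h t) (f' := fun t => deriv g t - deriv h t) (C := r')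
        (fun t _ => ((hgd t).hasDerivAt.sub (hhd t).hasDerivAt).hasDerivWithinAt)
        hder (Set.left_mem_Icc.2 hab) ht
      have h2 : g t + (h a - g a) - h t = (g t - h t) - (g a - h a) := by ring
      rw [h2]
      refine h1.trans (mul_le_mul_of_nonneg_left ?_ hr'.le)
      rw [Real.norm_of_nonneg (sub_nonneg.2 ht.1)]
      linarith [ht.2]
    refine ⟨(⟨fun t => g t + (h a - g a), by fun_prop⟩, F), ⟨_, hg1, fun t => ⟨rfl, ?_⟩⟩, ?_⟩
    · rw [hF]
      change deriv g t = deriv (fun t => g t + (h a - g a)) t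
      rw [deriv_add_const]
    · refine lt_of_le_of_lt (max_le ?_ ?_) hrr
      · rw [ContinuousMap.dist_le (by positivity)]
        intro t
        rw [dist_comm]
        have := hval t t.2
        refine this.trans ?_
        nlinarith
      · refine hdist.le.trans ?_
        nlinarith
  let Λ : C(Set.Icc a b, ℝ) × C(Set.Icc a b, ℝ) →L[ℝ] (Y → ℝ × ℝ) :=
    ContinuousLinearMap.pi fun y =>
      ((ContinuousMap.evalCLM ℝ (M := ℝ) (y : Set.Icc a b)).prodMap
        (ContinuousMap.evalCLM ℝ (M := ℝ) (y : Set.Icc a b)))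
  obtain ⟨F, ⟨g, hg, hFg⟩, hlt, hΛ⟩ := M.exists_approx_map_eq Λ hx hη
  refine ⟨g, hg, fun t ht => ?_, fun y hy => ?_⟩
  · have h1 : ‖(F - x).1 ⟨t, ht⟩‖ ≤ ‖F - x‖ :=
      ((F - x).1.norm_coe_le_norm _).trans (norm_fst_le _)
    have h2 : (F - x).1 ⟨t, ht⟩ = g t - h t := by
      rw [← (hFg ⟨t, ht⟩).1]; rfl
    rw [h2] at h1
    exact h1.trans hlt.le
  · have h1 := congrFun hΛ ⟨y, hy⟩
    have h2 : (F.1 y, F.2 y) = (h y, deriv h y) := h1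
    rw [(hFg y).1, (hFg y).2] at h2
    exact Prod.mk.inj h2

/-- Smooth bump functions at finitely many points of `ℝ` with pairwise disjoint supports. -/
theorem exists_disjoint_bumps {ι : Type*} [Fintype ι] [DecidableEq ι] {y : ι → ℝ}
    (hy : Function.Injective y) :
    ∃ b : ι → ℝ → ℝ, (∀ i, ContDiff ℝ 1 (b i)) ∧ (∀ i j, b i (y j) = if i = j then 1 else 0) ∧
      (∀ i j, deriv (b i) (y j) = 0) ∧ ∀ t, ∑ i, |b i t| ≤ 1 := by
  obtain ⟨r, hr, hsep⟩ : ∃ r > 0, ∀ i j, i ≠ j → 2 * r ≤ |y i - y j| := by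
    have h : ∀ᶠ r in nhdsWithin (0 : ℝ) (Set.Ioi 0), ∀ i j, i ≠ j → 2 * r ≤ |y i - y j| := by
      rw [Filter.eventually_all]; intro i
      rw [Filter.eventually_all]; intro j
      by_cases hij : i = j
      · simp [hij]
      have hpos : 0 < |y i - y j| := abs_pos.2 (sub_ne_zero.2 fun h => hij (hy h))
      filter_upwards [Ioo_mem_nhdsGT (half_pos hpos)] with r hr _
      linarith [hr.2]
    obtain ⟨r, hr, hr0⟩ := (h.and self_mem_nhdsWithin).exists
    exact ⟨r, hr0, hr⟩
  -- Centres are at least `2 * r` apart and the supports have radius `r`, so at most one bump is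
  -- non-zero at a point. Each is constant near every centre, hence the zero derivatives there.
  let B : ∀ i, ContDiffBump (y i) := fun i => ⟨r / 2, r, half_pos hr, half_lt_self hr⟩
  have hzero : ∀ i t, r ≤ |t - y i| → B i t = 0 := fun i t ht =>
    (B i).zero_of_le_dist (by rwa [Real.dist_eq])
  have hfar : ∀ i j t, i ≠ j → |t - y j| < r → r ≤ |t - y i| := by
    intro i j t hij ht
    have h1 := hsep i j hij
    have h2 : |y i - y j| ≤ |t - y j| + |t - y i| := by
      rw [abs_sub_comm t (y i), add_comm]
      exact abs_sub_le _ _ _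
    linarith
  refine ⟨fun i => B i, fun i => (B i).contDiff, fun i j => ?_, fun i j => ?_, fun t => ?_⟩
  · split_ifs with h
    · subst h
      exact (B i).one_of_mem_closedBall (Metric.mem_closedBall_self (half_pos hr).le)
    · exact hzero i _ (hfar i j _ h (by simpa using hr))
  · by_cases h : i = j
    · subst h
      rw [((B i).eventuallyEq_one).deriv_eq]
      exact deriv_const _ _
    · have h0 : (B i : ℝ → ℝ) =ᶠ[nhds (y j)] fun _ => 0 := by
        filter_upwards [Metric.ball_mem_nhds (y j) hr] with t ht
        exact hzero i t (hfar i j t h (by simpa [Real.dist_eq] using ht))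
      rw [h0.deriv_eq]
      exact deriv_const _ _
  · change ∑ i, |B i t| ≤ 1
    by_cases h : ∃ j, |t - y j| < r
    · obtain ⟨j, hj⟩ := h
      rw [Finset.sum_eq_single j (fun i _ hij => by rw [hzero i t (hfar i j t hij hj), abs_zero])
        (by simp)]
      rw [abs_of_nonneg (B j).nonneg]
      exact (B j).le_one
    · push Not at h
      simp [fun i => hzero i t (h i)]

/-- Functions dual to evaluation at finitely many points of `[a, b]`, with vanishing derivatives at
these points and Lebesgue constant close to `1`, among the linear combinations of dilated
translates of a smooth function that is not a polynomial. -/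
theorem exists_dual_dilateSpan {f : ℝ → ℝ} (hf : ContDiff ℝ ((⊤ : ℕ∞) : WithTop ℕ∞) f)
    (hnp : ¬ ∃ q : Polynomial ℝ, ∀ t, f t = q.eval t) {a b : ℝ} (hab : a ≤ b)
    {ι : Type*} [Fintype ι] [DecidableEq ι] {y : ι → ℝ} (hy : Function.Injective y)
    (hyI : ∀ i, y i ∈ Set.Icc a b) {η : ℝ} (hη : 0 < η) :
    ∃ g : ι → ℝ → ℝ, (∀ i, g i ∈ dilateSpan f) ∧
      (∀ i j, g i (y j) = if i = j then 1 else 0) ∧ (∀ i j, deriv (g i) (y j) = 0) ∧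
      ∀ t ∈ Set.Icc a b, ∑ i, |g i t| ≤ 1 + η := by
  classical
  obtain ⟨β, hβ, hβy, hβd, hβs⟩ := exists_disjoint_bumps hy
  -- The errors of all functions add up to at most `η`; the `+ 1` keeps the denominator positive for
  -- empty `ι`.
  have hk : 0 < η / (Fintype.card ι + 1) := by positivity
  choose g hg hgβ hgy using fun i => exists_mem_dilateSpan_approx hf hnp hab (hβ i)
    (Finset.univ.image fun j => (⟨y j, hyI j⟩ : Set.Icc a b)) hk
  have hmem : ∀ j, (⟨y j, hyI j⟩ : Set.Icc a b) ∈
      (Finset.univ.image fun j => (⟨y j, hyI j⟩ : Set.Icc a b)) := fun j =>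
    Finset.mem_image_of_mem _ (Finset.mem_univ j)
  refine ⟨g, hg, fun i j => ?_, fun i j => ?_, fun t ht => ?_⟩
  · rw [← hβy i j]; exact (hgy i _ (hmem j)).1
  · rw [← hβd i j]; exact (hgy i _ (hmem j)).2
  · calc ∑ i, |g i t| ≤ ∑ i, (|β i t| + η / (Fintype.card ι + 1)) := by
          refine Finset.sum_le_sum fun i _ => ?_
          have h1 := hgβ i t ht
          have h2 : |g i t| ≤ |β i t| + |g i t - β i t| := by
            have := abs_add_le (β i t) (g i t - β i t)
            rwa [add_sub_cancel] at this
          linarith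
      _ = ∑ i, |β i t| + Fintype.card ι * (η / (Fintype.card ι + 1)) := by
          rw [Finset.sum_add_distrib, Finset.sum_const, Finset.card_univ, nsmul_eq_mul]
      _ ≤ 1 + η := by
          refine add_le_add (hβs t) ?_
          rw [← mul_div_assoc, div_le_iff₀ (by positivity)]
          nlinarith

/-! ### Breakdown of deterministic and randomised algorithms. -/

/-- At the input `ι₀`, no finite set of evaluations tells apart `ι₀` from all inputs whose solutions
are far from those of `ι₀`. -/
def IndistinguishableAt {In Ix : Type} (ev : Ix → In → ℝ) {M : Type} [PseudoEMetricSpace M]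
    (Ξ : In → Set M) (ε : ENNReal) (ι₀ : In) : Prop :=
  ∀ S : Set Ix, S.Finite → ∃ ι, (∀ f ∈ S, ev f ι = ev f ι₀) ∧
    ∀ x, Metric.infEDist x (Ξ ι₀) ≤ ε → ε < Metric.infEDist x (Ξ ι)

theorem outputError_eq_top_or {M : Type} [PseudoEMetricSpace M] {S : Set M} {o : M ⊕ Unit}
    {ε : ENNReal} (hε : ε ≠ ⊤) (h : outputError S o ≤ ε) :
    ∃ x, o = Sum.inl x ∧ Metric.infEDist x S ≤ ε := by
  cases o with
  | inl x => exact ⟨x, rfl, h⟩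
  | inr u => exact absurd (top_le_iff.1 h) hε

/-- Agreement on the evaluations read forces the same output at both inputs, and one output cannot
serve two separated solution sets. -/
theorem GeneralAlgorithm.outputError_lt_of_agree {In Ix : Type} {ev : Ix → In → ℝ} {M : Type}
    [PseudoEMetricSpace M] {Ξ : In → Set M} {ε : ENNReal} (hε : ε ≠ ⊤) {ι₀ ι : In}
    (hsep : ∀ x, Metric.infEDist x (Ξ ι₀) ≤ ε → ε < Metric.infEDist x (Ξ ι))
    (Γ : GeneralAlgorithm ev M) (hag : ∀ f ∈ Γ.evals ι₀, ev f ι = ev f ι₀)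
    (h : outputError (Ξ ι₀) (Γ.out ι₀) ≤ ε) : ε < outputError (Ξ ι) (Γ.out ι) := by
  obtain ⟨x, hx, hle⟩ := outputError_eq_top_or hε h
  rw [Γ.out_eq ι₀ ι hag, hx]
  exact hsep x hle

theorem GeneralAlgorithm.exists_outputError_lt {In Ix : Type} {ev : Ix → In → ℝ} {M : Type}
    [PseudoEMetricSpace M] {Ξ : In → Set M} {ε : ENNReal} (hε : ε ≠ ⊤) {ι₀ : In}
    (hι₀ : IndistinguishableAt ev Ξ ε ι₀) (Γ : GeneralAlgorithm ev M) :
    ∃ ι, ε < outputError (Ξ ι) (Γ.out ι) := by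
  by_contra! hcon
  obtain ⟨x, hx, -⟩ := outputError_eq_top_or hε (hcon ι₀)
  obtain ⟨ι, hag, hsep⟩ := hι₀ _ (Γ.finite_evals ι₀ (by simp [hx]))
  exact absurd (Γ.outputError_lt_of_agree hε hsep hag (hcon ι₀)) (not_lt.2 (hcon ι))

/-- The set is closed: the distance to `S` is continuous on the outputs, and "does not halt" is an
isolated point. -/
theorem measurableSet_outputError_le {M : Type} [PseudoEMetricSpace M] (S : Set M) (ε : ENNReal) :
    @MeasurableSet (M ⊕ Unit) (borel (M ⊕ Unit)) {o | outputError S o ≤ ε} := by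
  borelize (M ⊕ Unit)
  refine IsClosed.measurableSet (isClosed_sum_iff.2 ⟨?_, ?_⟩)
  · exact isClosed_le Metric.continuous_infEDist continuous_const
  · exact isClosed_discrete _

/-- If a randomised algorithm succeeds at `ι₀` with probability more than `1/2`, then it fails with
probability more than `1/2` at an input that looks like `ι₀`. -/
theorem RandomisedGeneralAlgorithm.exists_half_lt_failure {In Ix : Type} [Encodable Ix]
    {ev : Ix → In → ℝ} {M : Type} [PseudoEMetricSpace M] {Ξ : In → Set M} {ε : ENNReal}
    (hε : ε ≠ ⊤) {ι₀ : In} (hι₀ : IndistinguishableAt ev Ξ ε ι₀)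
    (R : RandomisedGeneralAlgorithm ev M)
    (h : 1 / 2 < R.P ι₀ {Γ | outputError (Ξ ι₀) (Γ.1.out ι₀) ≤ ε}) :
    ∃ ι, 1 / 2 < R.P ι {Γ | ε < outputError (Ξ ι) (Γ.1.out ι)} := by
  let := R.𝓕
  set G : Set R.X := {Γ | outputError (Ξ ι₀) (Γ.1.out ι₀) ≤ ε}
  have hG : MeasurableSet G := R.measurable_out ι₀ (measurableSet_outputError_le _ _)
  -- Successful runs that read only the first `n` evaluations. These events increase to the whole
  -- success event because a run with finite error halts, so one of them already has probability
  -- above `1/2`.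
  let E : ℕ → Set R.X := fun n => {Γ | ∀ f ∈ Γ.1.evals ι₀, Encodable.encode f ≤ n} ∩ G
  have hEm : ∀ n, MeasurableSet (E n) := fun n => (R.measurable_runtime n ι₀).inter hG
  have hmono : Monotone E := fun a b hab Γ hΓ => ⟨fun f hf => (hΓ.1 f hf).trans hab, hΓ.2⟩
  have hU : ⋃ n, E n = G := by
    refine Set.Subset.antisymm (Set.iUnion_subset fun n => Set.inter_subset_right) fun Γ hΓ => ?_
    obtain ⟨x, hx, -⟩ := outputError_eq_top_or hε hΓ
    have hfin := Γ.1.finite_evals ι₀ (by simp [hx])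
    obtain ⟨n, hn⟩ := (hfin.image Encodable.encode).bddAbove
    exact Set.mem_iUnion.2 ⟨n, fun f hf => hn (Set.mem_image_of_mem _ hf), hΓ⟩
  rw [← hU, hmono.measure_iUnion] at h
  obtain ⟨n, hn⟩ := lt_iSup_iff.1 h
  have hfin : {f : Ix | Encodable.encode f ≤ n}.Finite :=
    (Set.finite_Iic n).preimage Encodable.encode_injective.injOn
  obtain ⟨ι, hag, hsep⟩ := hι₀ _ hfin
  refine ⟨ι, ?_⟩
  have hP := R.consistent ι₀ ι (E n) (hEm n) fun Γ hΓ f hf => (hag f (hΓ.1 f hf)).symm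
  rw [hP] at hn
  refine hn.trans_le (MeasureTheory.measure_mono fun Γ hΓ => ?_)
  exact Γ.1.outputError_lt_of_agree hε hsep (fun f hf => hag f (hΓ.1 f hf)) hΓ.2

theorem RandomisedGeneralAlgorithm.success_add_failure {In Ix : Type} [Encodable Ix]
    {ev : Ix → In → ℝ} {M : Type} [PseudoEMetricSpace M] (Ξ : In → Set M) (ε : ENNReal)
    (R : RandomisedGeneralAlgorithm ev M) (ι : In) :
    R.P ι {Γ | outputError (Ξ ι) (Γ.1.out ι) ≤ ε} +
      R.P ι {Γ | ε < outputError (Ξ ι) (Γ.1.out ι)} = 1 := by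
  let := R.𝓕
  have := R.prob ι
  have hG : MeasurableSet {Γ : R.X | outputError (Ξ ι) (Γ.1.out ι) ≤ ε} :=
    R.measurable_out ι (measurableSet_outputError_le _ _)
  rw [← MeasureTheory.prob_add_prob_compl (μ := R.P ι) hG]
  congr 2
  ext Γ
  simp

theorem RandomisedGeneralAlgorithm.exists_success_le_half {In Ix : Type} [Encodable Ix]
    {ev : Ix → In → ℝ} {M : Type} [PseudoEMetricSpace M] {Ξ : In → Set M} {ε : ENNReal}
    (hε : ε ≠ ⊤) {ι₀ : In} (hι₀ : IndistinguishableAt ev Ξ ε ι₀)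
    (R : RandomisedGeneralAlgorithm ev M) :
    ∃ ι, R.P ι {Γ | outputError (Ξ ι) (Γ.1.out ι) ≤ ε} ≤ 1 / 2 := by
  by_contra! hcon
  obtain ⟨ι, hι⟩ := R.exists_half_lt_failure hε hι₀ (hcon ι₀)
  have h1 := ENNReal.add_lt_add (hcon ι) hι
  rw [R.success_add_failure Ξ ε ι, ENNReal.add_halves] at h1
  exact lt_irrefl _ h1

/-- Either success at `ι₀` has probability at most `1/2`, so that `ι₀` itself is an input with
failure probability above `p`, or the failure is transferred to a look-alike of `ι₀`. -/
theorem le_strongProbBreakdown {In Ix : Type} [Encodable Ix]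
    {ev : Ix → In → ℝ} {M : Type} [PseudoEMetricSpace M] {Ξ : In → Set M} {ε : ENNReal}
    (hε : ε ≠ ⊤) (hε0 : 0 < ε) {ι₀ : In} (hι₀ : IndistinguishableAt ev Ξ ε ι₀) {p : ℝ}
    (hp : p < 1 / 2) : ε ≤ strongProbBreakdown ev Ξ p := by
  have hp' : ENNReal.ofReal p < 1 / 2 := by
    have h1 := (ENNReal.ofReal_lt_ofReal_iff (by norm_num)).2 hp
    rwa [ENNReal.ofReal_div_of_pos two_pos, ENNReal.ofReal_one, ENNReal.ofReal_ofNat] at h1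
  refine le_sSup ⟨hε0, fun R => ?_⟩
  by_contra! hcon
  rcases le_or_gt (R.P ι₀ {Γ | outputError (Ξ ι₀) (Γ.1.out ι₀) ≤ ε}) (1 / 2) with h | h
  · have h1 := ENNReal.add_lt_add_of_le_of_lt (ne_top_of_le_ne_top (by norm_num) h) h ((hcon ι₀).trans_lt hp')
    rw [R.success_add_failure Ξ ε ι₀, ENNReal.add_halves] at h1
    exact lt_irrefl _ h1
  · obtain ⟨ι, hι⟩ := R.exists_half_lt_failure hε hι₀ h
    exact absurd ((hcon ι).trans_lt hp') (not_lt.2 hι.le)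

/-! ### Networks with one hidden layer -/

theorem exists_realizes_ridge_sum {s m N : ℕ} {σ : Fin s → ℂ → ℂ} {j : Fin s} {f : ℝ → ℝ}
    (hσ : ∀ t : ℝ, σ j (t : ℂ) = (f t : ℂ)) {ι : Type*} [Fintype ι] (u : Euc m) (l c : ι → ℝ)
    (z : ι → Euc N) :
    ∃ net : NeuralNet s m N,
      net.Realizes σ fun y => ∑ q, f (l q * inner ℝ u y + c q) • z q := by
  let e := Fintype.equivFin ι
  refine ⟨⟨Fintype.card ι, .layer .input (Matrix.of fun k i => ((l (e.symm k) * u i : ℝ) : ℂ))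
    (fun k => (c (e.symm k) : ℂ)) Finset.univ j, Matrix.of fun i k => ((z (e.symm k) i : ℝ) : ℂ),
    0, 0⟩, fun y i => ?_⟩
  have hin : ∀ k, (Matrix.of fun k i => ((l (e.symm k) * u i : ℝ) : ℂ)).mulVec
      (fun j => ((y j : ℝ) : ℂ)) k + (c (e.symm k) : ℂ) =
      ((l (e.symm k) * inner ℝ u y + c (e.symm k) : ℝ) : ℂ) := by
    intro k
    simp only [Matrix.mulVec, dotProduct, Matrix.of_apply, PiLp.inner_apply, RCLike.inner_apply,
      conj_trivial]
    push_cast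
    rw [Finset.mul_sum]
    congr 1
    exact Finset.sum_congr rfl fun i _ => by ring
  simp only [NeuralNet.eval, HiddenLayers.eval, Finset.mem_univ, if_true, Pi.add_apply, hin, hσ,
    Matrix.zero_mulVec, Pi.zero_apply, add_zero]
  simp only [Matrix.mulVec, dotProduct, Matrix.of_apply]
  rw [← e.symm.sum_comp]
  simp only [WithLp.ofLp_sum, Finset.sum_apply, PiLp.smul_apply, smul_eq_mul]
  push_cast
  exact Finset.sum_congr rfl fun k _ => mul_comm _ _

/-- Each `g i` is a finite combination of dilated translates; each term becomes one neuron of a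
single hidden layer. -/
theorem exists_realizes_of_mem_dilateSpan {s m N : ℕ} {σ : Fin s → ℂ → ℂ} {j : Fin s} {f : ℝ → ℝ}
    (hσ : ∀ t : ℝ, σ j (t : ℂ) = (f t : ℂ)) {ι : Type*} [Fintype ι] (u : Euc m) (g : ι → ℝ → ℝ)
    (hg : ∀ i, g i ∈ dilateSpan f) (x : ι → Euc N) :
    ∃ net : NeuralNet s m N, net.Realizes σ fun y => ∑ i, g i (inner ℝ u y) • x i := by
  choose C hC using fun i => Finsupp.mem_span_range_iff_exists_finsupp.1 (hg i)
  obtain ⟨net, hnet⟩ := exists_realizes_ridge_sum hσ (ι := Σ i, (C i).support) u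
    (fun q => q.2.1.1) (fun q => q.2.1.2) (fun q => C q.1 q.2.1 • x q.1)
  refine ⟨net, ?_⟩
  convert hnet using 2 with y
  rw [Fintype.sum_sigma]
  refine Finset.sum_congr rfl fun i _ => ?_
  rw [← hC i, Finsupp.sum, Finset.sum_apply, Finset.sum_smul, ← Finset.sum_coe_sort]
  refine Finset.sum_congr rfl fun q _ => ?_
  simp only [Pi.smul_apply, smul_eq_mul]
  rw [smul_smul, mul_comm]

/-! ### Optimal maps -/

/-- The inverse of `A` on `A(M₁)` recovers every point, so the optimality constant is `0` and
optimality means exact recovery. -/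
theorem isOptimalMap_iff_of_injOn {N m : ℕ} {A : Euc N →L[ℝ] Euc m} {M₁ : Set (Euc N)}
    (hA : Set.InjOn A M₁) {φ : Euc m → Euc N} :
    IsOptimalMap A M₁ φ ↔ ∀ x ∈ M₁, φ (A x) = x := by
  have h0 : optConst A M₁ = 0 := by
    refine nonpos_iff_eq_zero.1 (iInf_le_of_le (fun y => {Function.invFunOn A M₁ y}) ?_)
    refine iSup₂_le fun x hx => ?_
    change Metric.hausdorffEDist {Function.invFunOn A M₁ (A x)} {x} ≤ 0
    rw [hA.leftInvOn_invFunOn hx]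
    simp
  simp only [IsOptimalMap, h0, nonpos_iff_eq_zero, ENNReal.iSup_eq_zero,
    Metric.hausdorffEDist_singleton, edist_eq_zero]

/-! ### The family of training sets -/

/-- A unit vector `v` in the kernel of `A` and a vector `w` outside of the kernel, which are
used to build a family of inverse problems with solutions in the ball of radius `a`. -/
structure KernelPair {N m : ℕ} (A : Euc N →L[ℝ] Euc m) (a : ℝ) where
  v : Euc N
  w : Euc N
  norm_v : ‖v‖ = 1
  map_v : A v = 0
  norm_w : ‖w‖ ≤ a
  norm_map_w : ‖A w‖ ≤ 1
  map_w_ne : A w ≠ 0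
  pos : 0 < a
  le_one : a ≤ 1

theorem KernelPair.nonempty {N m : ℕ} (hNm : m < N) {A : Euc N →L[ℝ] Euc m} (hA : A ≠ 0) {a : ℝ}
    (ha : 0 < a) (ha1 : a ≤ 1) : Nonempty (KernelPair A a) := by
  obtain ⟨v₀, hv₀, hv₀0⟩ := Submodule.exists_mem_ne_zero_of_ne_bot
    (LinearMap.ker_ne_bot_of_finrank_lt (f := (A : Euc N →ₗ[ℝ] Euc m)) (by simpa using hNm))
  have hv₀' : A v₀ = 0 := hv₀
  obtain ⟨w₀, hw₀⟩ : ∃ w, A w ≠ 0 := by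
    by_contra! h
    exact hA (ContinuousLinearMap.ext h)
  have hw₀' : w₀ ≠ 0 := fun h => hw₀ (by rw [h, map_zero])
  have h1 : 0 < ‖w₀‖ := norm_pos_iff.2 hw₀'
  have h2 : 0 < ‖A w₀‖ := norm_pos_iff.2 hw₀
  have hd : 0 < ‖w₀‖ + a * ‖A w₀‖ := by positivity
  -- This scaling of `w₀` gives `‖w‖ ≤ a` and `‖A w‖ ≤ 1` at once.
  refine ⟨⟨‖v₀‖⁻¹ • v₀, (a / (‖w₀‖ + a * ‖A w₀‖)) • w₀, norm_smul_inv_norm hv₀0, ?_, ?_, ?_, ?_, ha,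
    ha1⟩⟩
  · rw [map_smul, hv₀', smul_zero]
  · rw [norm_smul, Real.norm_of_nonneg (by positivity), div_mul_eq_mul_div, div_le_iff₀ hd]
    exact mul_le_mul_of_nonneg_left (by nlinarith) ha.le
  · rw [map_smul, norm_smul, Real.norm_of_nonneg (by positivity), div_mul_eq_mul_div,
      div_le_iff₀ hd]
    linarith
  · rw [map_smul]
    exact smul_ne_zero (by positivity) hw₀

namespace KernelPair

/-- The parameter range of the family of training sets. -/
abbrev Param : Type := Set.Icc (0 : ℝ) (1 / 2)

/-- The measurements of the points of the initial domain are `nodeParam t i • A w`. -/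
noncomputable def nodeParam {ℓ : ℕ} (t : Param) : Fin ℓ ⊕ Bool → ℝ
  | .inl k => ((k : ℝ) + 1) / (2 * ℓ) + t
  | .inr true => 0
  -- For `t = 0` this node would collide with the node `0`. The value `1` is free, since the other
  -- nodes are then at most `1/2`.
  | .inr false => if (t : ℝ) = 0 then 1 else t

theorem base_mem {ℓ : ℕ} (k : Fin ℓ) :
    0 < ((k : ℝ) + 1) / (2 * ℓ) ∧ ((k : ℝ) + 1) / (2 * ℓ) ≤ 1 / 2 := by
  have hk : (k : ℝ) + 1 ≤ ℓ := by exact_mod_cast k.2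
  have hℓ : (0 : ℝ) < ℓ := by have := (k : ℕ).cast_nonneg (α := ℝ); linarith
  refine ⟨by positivity, ?_⟩
  rw [div_le_div_iff₀ (by positivity) two_pos]
  linarith

theorem nodeParam_mem {ℓ : ℕ} (t : Param) (i : Fin ℓ ⊕ Bool) :
    nodeParam t i ∈ Set.Icc (0 : ℝ) 1 := by
  have h0 := t.2.1
  have h1 := t.2.2
  rcases i with k | b
  · have := base_mem k
    exact ⟨by simp only [nodeParam]; linarith, by simp only [nodeParam]; linarith⟩
  · cases b
    · simp only [nodeParam]
      split_ifs
      · simp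
      · exact ⟨h0, by linarith⟩
    · simp [nodeParam]

theorem nodeParam_injective {ℓ : ℕ} (t : Param) :
    Function.Injective (nodeParam (ℓ := ℓ) t) := by
  have h0 := t.2.1
  have h1 := t.2.2
  have hlt : ∀ k : Fin ℓ, nodeParam t (.inl k) ≠ nodeParam (ℓ := ℓ) t (.inr false) := by
    intro k
    have := base_mem k
    simp only [nodeParam]
    split_ifs with h
    · rw [h]; linarith
    · linarith
  have hpos : ∀ k : Fin ℓ, nodeParam t (.inl k) ≠ nodeParam (ℓ := ℓ) t (.inr true) := by
    intro k
    have := base_mem k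
    simp only [nodeParam]
    linarith
  have hb : nodeParam (ℓ := ℓ) t (.inr false) ≠ nodeParam (ℓ := ℓ) t (.inr true) := by
    simp only [nodeParam]
    split_ifs with h
    · exact one_ne_zero
    · exact h
  rintro (k | _ | _) (k' | _ | _) h
  · have hℓ : (0 : ℝ) < ℓ := by exact_mod_cast k.pos
    simp only [nodeParam] at h
    have h2 : ((k : ℝ) + 1) / (2 * ℓ) = ((k' : ℝ) + 1) / (2 * ℓ) := by linarith
    rw [div_left_inj' (by positivity : (2 * ℓ : ℝ) ≠ 0)] at h2
    have h3 : (k : ℝ) = k' := by linarith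
    have h4 : k = k' := Fin.ext (by exact_mod_cast h3)
    rw [h4]
  · exact absurd h (hlt k)
  · exact absurd h (hpos k)
  · exact absurd h.symm (hlt k')
  · rfl
  · exact absurd h hb
  · exact absurd h.symm (hpos k')
  · exact absurd h.symm hb
  · rfl

/-- The points of the initial domain. -/
noncomputable def nodeVal {N m : ℕ} {A : Euc N →L[ℝ] Euc m} {a : ℝ} (P : KernelPair A a) {ℓ : ℕ}
    (t : Param) : Fin ℓ ⊕ Bool → Euc N
  | .inl k => (((k : ℝ) + 1) / (2 * ℓ) + t) • P.w
  -- The sign jump at `t = 0` causes the breakdown. For `t ≠ 0` the last point is close to `-(a •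
  -- v)` when `t` is small, and this causes the instability. Its coefficients `t` and `1 - t` keep
  -- it in the ball of radius `a`.
  | .inr true => if (t : ℝ) = 0 then -(a • P.v) else a • P.v
  | .inr false => if (t : ℝ) = 0 then P.w else (t : ℝ) • P.w - ((1 - t) * a) • P.v

theorem map_nodeVal {N m : ℕ} {A : Euc N →L[ℝ] Euc m} {a : ℝ} (P : KernelPair A a) {ℓ : ℕ}
    (t : Param) (i : Fin ℓ ⊕ Bool) : A (P.nodeVal t i) = nodeParam t i • A P.w := by
  rcases i with k | b
  · simp [nodeVal, nodeParam]
  · cases b <;> simp only [nodeVal, nodeParam] <;> split_ifs <;> simp [P.map_v]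

theorem norm_nodeVal_le {N m : ℕ} {A : Euc N →L[ℝ] Euc m} {a : ℝ} (P : KernelPair A a) {ℓ : ℕ}
    (t : Param) (i : Fin ℓ ⊕ Bool) : ‖P.nodeVal t i‖ ≤ a := by
  have h0 := t.2.1
  have h1 := t.2.2
  have ha := P.pos
  have hv : ‖a • P.v‖ = a := by rw [norm_smul, P.norm_v, mul_one, Real.norm_of_nonneg ha.le]
  have hw := P.norm_w
  rcases i with k | b
  · have hmem := nodeParam_mem (ℓ := ℓ) t (.inl k)
    simp only [nodeParam] at hmem
    simp only [nodeVal]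
    rw [norm_smul, Real.norm_of_nonneg hmem.1]
    nlinarith [hmem.1, hmem.2, norm_nonneg P.w]
  · cases b <;> simp only [nodeVal] <;> split_ifs
    · exact hw
    · refine (norm_sub_le _ _).trans ?_
      rw [norm_smul, norm_smul, P.norm_v, Real.norm_of_nonneg h0,
        Real.norm_of_nonneg (mul_nonneg (by linarith) ha.le)]
      nlinarith
    · rw [norm_neg, hv]
    · rw [hv]

theorem graph_nodeVal_injective {N m : ℕ} {A : Euc N →L[ℝ] Euc m} {a : ℝ} (P : KernelPair A a)
    {ℓ : ℕ} (t : Param) : Function.Injective fun i : Fin ℓ ⊕ Bool =>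
      ((P.nodeVal t i, A (P.nodeVal t i)) : Euc N × Euc m) := by
  intro i j h
  have h2 : A (P.nodeVal t i) = A (P.nodeVal t j) := congrArg Prod.snd h
  rw [map_nodeVal, map_nodeVal] at h2
  exact nodeParam_injective t (smul_left_injective ℝ P.map_w_ne h2)

theorem norm_map_nodeVal_le {N m : ℕ} {A : Euc N →L[ℝ] Euc m} {a : ℝ} (P : KernelPair A a) {ℓ : ℕ}
    (t : Param) (i : Fin ℓ ⊕ Bool) : ‖A (P.nodeVal t i)‖ ≤ 1 := by
  have hmem := nodeParam_mem t i
  rw [map_nodeVal, norm_smul, Real.norm_of_nonneg hmem.1]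
  exact mul_le_one₀ hmem.2 (norm_nonneg _) P.norm_map_w

/-- The pairs of the training set with parameter `t`. -/
noncomputable def trainingPairs {N m : ℕ} {A : Euc N →L[ℝ] Euc m} {a : ℝ} (P : KernelPair A a)
    (ℓ : ℕ) (t : Param) : Finset (Euc N × Euc m) :=
  Finset.univ.map ⟨fun k : Fin ℓ => (P.nodeVal t (.inl k), A (P.nodeVal t (.inl k))),
    (P.graph_nodeVal_injective t).comp Sum.inl_injective⟩

theorem mem_trainingPairs {N m : ℕ} {A : Euc N →L[ℝ] Euc m} {a : ℝ} (P : KernelPair A a)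
    {ℓ : ℕ} {t : Param} {p : Euc N × Euc m} :
    p ∈ P.trainingPairs ℓ t ↔
      ∃ k : Fin ℓ, (P.nodeVal t (.inl k), A (P.nodeVal t (.inl k))) = p := by
  rw [trainingPairs, Finset.mem_map]
  exact ⟨fun ⟨k, _, h⟩ => ⟨k, h⟩, fun ⟨k, h⟩ => ⟨k, Finset.mem_univ k, h⟩⟩

/-- The training set with parameter `t`. -/
noncomputable def trainingSet {N m : ℕ} {A : Euc N →L[ℝ] Euc m} {a : ℝ} (P : KernelPair A a)
    (ℓ : ℕ) (t : Param) : TrainingSet N m ℓ :=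
  ⟨P.trainingPairs ℓ t, by rw [trainingPairs, Finset.card_map, Finset.card_univ, Fintype.card_fin],
    fun p hp => by
      obtain ⟨k, hk⟩ := P.mem_trainingPairs.1 hp
      have h1 := (P.norm_nodeVal_le t (.inl k)).trans P.le_one
      have h2 := P.norm_map_nodeVal_le t (.inl k)
      rw [← hk]
      exact ⟨h1, h2⟩⟩

theorem mem_trainingSet {N m : ℕ} {A : Euc N →L[ℝ] Euc m} {a : ℝ} (P : KernelPair A a)
    {ℓ : ℕ} {t : Param} {p : Euc N × Euc m} :
    p ∈ (P.trainingSet ℓ t).1 ↔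
      ∃ k : Fin ℓ, (P.nodeVal t (.inl k), A (P.nodeVal t (.inl k))) = p :=
  P.mem_trainingPairs

/-- The sum of all measurement vectors in the training set determines `t`. -/
theorem trainingSet_injective {N m : ℕ} {A : Euc N →L[ℝ] Euc m} {a : ℝ} (P : KernelPair A a)
    {ℓ : ℕ} (hℓ : 0 < ℓ) : Function.Injective (P.trainingSet ℓ) := by
  intro t t' h
  have hsum : ∀ t : Param, ∑ p ∈ (P.trainingSet ℓ t).1, p.2 =
      (∑ k : Fin ℓ, ((k : ℝ) + 1) / (2 * ℓ) + ℓ * t) • A P.w := by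
    intro t
    simp only [trainingSet, trainingPairs, Finset.sum_map, Function.Embedding.coeFn_mk, map_nodeVal, nodeParam]
    rw [← Finset.sum_smul, Finset.sum_add_distrib]
    simp
  have h1 := hsum t
  rw [h, hsum t'] at h1
  have h2 := add_left_cancel (smul_left_injective ℝ P.map_w_ne h1)
  exact Subtype.ext (mul_left_cancel₀ (by positivity) h2).symm

/-- The training set with parameter `t` is a translate of the one at `0`, and translation preserves
the lexicographic order, so the enumerations correspond. Otherwise close training sets could have
distant lists of measurements. -/
theorem nth_trainingSet {N m : ℕ} {A : Euc N →L[ℝ] Euc m} {a : ℝ} (P : KernelPair A a)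
    {ℓ : ℕ} (t₀ t : Param) (ht₀ : (t₀ : ℝ) = 0) (k : Fin ℓ) :
    (P.trainingSet ℓ t).nth k =
      (P.trainingSet ℓ t₀).nth k + ((t : ℝ) • P.w, (t : ℝ) • A P.w) := by
  set d : Euc N × Euc m := ((t : ℝ) • P.w, (t : ℝ) • A P.w)
  have hadd : ∀ p q, lexKey N m (p + q) = lexKey N m p + lexKey N m q := fun _ _ => rfl
  have hkey : ∀ k, lexKey N m ((P.trainingSet ℓ t₀).nth k) = ((P.trainingSet ℓ t₀).1.map
      (lexKey N m).toEmbedding).orderEmbOfFin (((P.trainingSet ℓ t₀).1.card_map _).trans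
      (P.trainingSet ℓ t₀).2.1) k := fun k => Equiv.apply_symm_apply _ _
  have hmem₀ : ∀ k, (P.trainingSet ℓ t₀).nth k ∈ (P.trainingSet ℓ t₀).1 := by
    intro k
    have h1 := Finset.orderEmbOfFin_mem ((P.trainingSet ℓ t₀).1.map (lexKey N m).toEmbedding)
      (((P.trainingSet ℓ t₀).1.card_map _).trans (P.trainingSet ℓ t₀).2.1) k
    rw [← hkey k] at h1
    exact (Finset.mem_map' _).1 h1
  have huniq := Finset.orderEmbOfFin_unique (s := (P.trainingSet ℓ t).1.map
      (lexKey N m).toEmbedding) (((P.trainingSet ℓ t).1.card_map _).trans (P.trainingSet ℓ t).2.1)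
    (f := fun k => lexKey N m ((P.trainingSet ℓ t₀).nth k + d)) (fun k => by
      refine (Finset.mem_map' _).2 ?_
      obtain ⟨k', hk'⟩ := P.mem_trainingSet.1 (hmem₀ k)
      rw [← hk', P.mem_trainingSet]
      refine ⟨k', Prod.ext ?_ ?_⟩
      · simp [nodeVal, ht₀, d, add_smul]
      · simp [nodeVal, ht₀, d, add_smul]) (by
      intro k k' hkk'
      simp only [hadd, hkey]
      exact add_lt_add_left ((OrderEmbedding.strictMono _) hkk') _)
  rw [TrainingSet.nth, ← huniq, Equiv.symm_apply_apply]

theorem abs_meas_sub_le {N m : ℕ} {A : Euc N →L[ℝ] Euc m} {a : ℝ} (P : KernelPair A a)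
    {ℓ : ℕ} (t₀ t : Param) (ht₀ : (t₀ : ℝ) = 0) (i : MeasIdx N m ℓ) :
    |(P.trainingSet ℓ t₀).meas i - (P.trainingSet ℓ t).meas i| ≤ t := by
  have ht := t.2.1
  have hcoord : ∀ {n : ℕ} (z : Euc n) (j : Fin n), ‖z‖ ≤ 1 → |(t : ℝ) * z j| ≤ t := by
    intro n z j hz
    rw [abs_mul, abs_of_nonneg ht]
    exact mul_le_of_le_one_right ht ((PiLp.norm_apply_le z j).trans hz)
  obtain ⟨k, i | j⟩ := i
  · simp only [TrainingSet.meas, P.nth_trainingSet t₀ t ht₀ k]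
    simpa using hcoord P.w i (P.norm_w.trans P.le_one)
  · simp only [TrainingSet.meas, P.nth_trainingSet t₀ t ht₀ k]
    simpa using hcoord (A P.w) j P.norm_map_w

end KernelPair

/-! ### Initial domains and optimal networks of the family. -/

namespace KernelPair

/-- All training sets of the family. -/
def collection {N m : ℕ} {A : Euc N →L[ℝ] Euc m} {a : ℝ} (P : KernelPair A a) (ℓ : ℕ) :
    Set (TrainingSet N m ℓ) :=
  Set.range (P.trainingSet ℓ)

/-- The initial domains of the training sets of the family. -/
def initialDomain {N m : ℕ} {A : Euc N →L[ℝ] Euc m} {a : ℝ} (P : KernelPair A a) {ℓ : ℕ}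
    (T : TrainingSet N m ℓ) : Set (Euc N) :=
  {x | ∃ t, P.trainingSet ℓ t = T ∧ x ∈ Set.range (P.nodeVal (ℓ := ℓ) t)}

theorem initialDomain_trainingSet {N m : ℕ} {A : Euc N →L[ℝ] Euc m} {a : ℝ} (P : KernelPair A a)
    {ℓ : ℕ} (hℓ : 0 < ℓ) (t : Param) :
    P.initialDomain (P.trainingSet ℓ t) = Set.range (P.nodeVal (ℓ := ℓ) t) := by
  ext x
  refine ⟨fun ⟨t', h, hx⟩ => ?_, fun hx => ⟨t, rfl, hx⟩⟩
  rwa [P.trainingSet_injective hℓ h] at hx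

theorem isTrainingDomain {N m : ℕ} {A : Euc N →L[ℝ] Euc m} {a : ℝ} (P : KernelPair A a)
    (ℓ : ℕ) : IsTrainingDomain A (P.collection ℓ) P.initialDomain := by
  rintro _ ⟨t, rfl⟩ p hp
  obtain ⟨k, rfl⟩ := P.mem_trainingSet.1 hp
  exact ⟨⟨t, rfl, Sum.inl k, rfl⟩, rfl⟩

theorem isOptimalMap_iff {N m : ℕ} {A : Euc N →L[ℝ] Euc m} {a : ℝ} (P : KernelPair A a)
    {ℓ : ℕ} (hℓ : 0 < ℓ) (t : Param) {φ : Euc m → Euc N} :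
    IsOptimalMap A (P.initialDomain (P.trainingSet ℓ t)) φ ↔
      ∀ i : Fin ℓ ⊕ Bool, φ (A (P.nodeVal t i)) = P.nodeVal t i := by
  rw [P.initialDomain_trainingSet hℓ, isOptimalMap_iff_of_injOn, Set.forall_mem_range]
  rintro _ ⟨i, rfl⟩ _ ⟨j, rfl⟩ h
  rw [map_nodeVal, map_nodeVal] at h
  rw [nodeParam_injective t (smul_left_injective ℝ P.map_w_ne h)]

theorem map_nodeVal_mem_measurementSet {N m : ℕ} {A : Euc N →L[ℝ] Euc m} {a : ℝ}
    (P : KernelPair A a) {ℓ : ℕ} (t : Param) (i : Fin ℓ ⊕ Bool) :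
    A (P.nodeVal t i) ∈ measurementSet A (P.collection ℓ) P.initialDomain :=
  Set.mem_biUnion (Set.mem_range_self t) ⟨_, ⟨t, rfl, Set.mem_range_self i⟩, rfl⟩

theorem exists_eq_smul_of_mem_measurementSet {N m : ℕ} {A : Euc N →L[ℝ] Euc m} {a : ℝ}
    (P : KernelPair A a) {ℓ : ℕ} {y : Euc m}
    (hy : y ∈ measurementSet A (P.collection ℓ) P.initialDomain) :
    ∃ r ∈ Set.Icc (0 : ℝ) 1, y = r • A P.w := by
  obtain ⟨T, -, _, ⟨t, -, i, rfl⟩, rfl⟩ := Set.mem_iUnion₂.1 hy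
  exact ⟨_, nodeParam_mem t i, P.map_nodeVal t i⟩

/-- There are smooth optimal networks whose derivative vanishes at all measurements of the initial
domain and whose values at the measurements of all inverse problems of the collection are
almost bounded by `a`. -/
theorem exists_optimal_network {N m : ℕ} {A : Euc N →L[ℝ] Euc m} {a : ℝ} (P : KernelPair A a)
    {ℓ : ℕ} (hℓ : 0 < ℓ) {s : ℕ} {σ : Fin s → ℂ → ℂ} {j : Fin s} {f : ℝ → ℝ}
    (hf : ContDiff ℝ ((⊤ : ℕ∞) : WithTop ℕ∞) f)
    (hnp : ¬ ∃ p : Polynomial ℝ, ∀ t, f t = p.eval t)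
    (hσ : ∀ t : ℝ, σ j (t : ℂ) = (f t : ℂ)) (t : Param) {η : ℝ} (hη : 0 < η) :
    ∃ φ ∈ optimalNNsD σ A (P.collection ℓ) P.initialDomain 0 (P.trainingSet ℓ t),
      ∀ y ∈ measurementSet A (P.collection ℓ) P.initialDomain, ‖φ.1 y‖ ≤ (1 + η) * a := by
  obtain ⟨g, hg, hgy, hgd, hgs⟩ := exists_dual_dilateSpan hf hnp zero_le_one
    (nodeParam_injective (ℓ := ℓ) t) (nodeParam_mem t) hη
  -- All measurements lie on the segment from `0` to `A w`; this `u` reads off the coordinate on it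
  -- and reduces the interpolation to one variable.
  set u : Euc m := (‖A P.w‖ ^ 2)⁻¹ • A P.w
  have hu : ∀ r : ℝ, inner ℝ u (r • A P.w) = r := by
    intro r
    have h1 : ‖A P.w‖ ≠ 0 := norm_ne_zero_iff.2 P.map_w_ne
    rw [inner_smul_left, inner_smul_right, real_inner_self_eq_norm_sq]
    simp only [map_inv₀, map_pow, conj_trivial]
    field_simp
  set φ : Euc m → Euc N := fun y => ∑ i, g i (inner ℝ u y) • P.nodeVal t i
  have hgsm : ∀ i, ContDiff ℝ ((⊤ : ℕ∞) : WithTop ℕ∞) (g i) :=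
    fun i => contDiff_of_mem_dilateSpan hf (hg i)
  have hbound : ∀ y ∈ measurementSet A (P.collection ℓ) P.initialDomain,
      ‖φ y‖ ≤ (1 + η) * a := by
    intro y hy
    obtain ⟨r, hr, rfl⟩ := P.exists_eq_smul_of_mem_measurementSet hy
    simp only [φ, hu]
    calc ‖∑ i, g i r • P.nodeVal t i‖ ≤ ∑ i, |g i r| * a := by
          refine norm_sum_le_of_le _ fun i _ => ?_
          rw [norm_smul, Real.norm_eq_abs]
          exact mul_le_mul_of_nonneg_left (P.norm_nodeVal_le t i) (abs_nonneg _)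
      _ = (∑ i, |g i r|) * a := by rw [Finset.sum_mul]
      _ ≤ (1 + η) * a := mul_le_mul_of_nonneg_right (hgs r hr) P.pos.le
  have hopt : ∀ i : Fin ℓ ⊕ Bool, φ (A (P.nodeVal t i)) = P.nodeVal t i := by
    intro i
    simp only [φ, map_nodeVal, hu, hgy]
    simp
  have hder : ∀ i : Fin ℓ ⊕ Bool, fderiv ℝ φ (A (P.nodeVal t i)) = 0 := by
    intro i
    have hinner : HasFDerivAt (fun y : Euc m => (inner ℝ u y : ℝ)) (innerSL ℝ u)
      (A (P.nodeVal t i)) := (innerSL ℝ u).hasFDerivAt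
    have h1 : ∀ k : Fin ℓ ⊕ Bool, HasFDerivAt (𝕜 := ℝ)
        (fun y : Euc m => g k (inner ℝ u y) • P.nodeVal t k) (0 : Euc m →L[ℝ] Euc N)
        (A (P.nodeVal t i)) := by
      intro k
      have hgk : HasDerivAt (g k) 0 (inner ℝ u (A (P.nodeVal t i))) := by
        rw [map_nodeVal, hu, ← hgd k i]
        exact ((hgsm k).differentiable (by simp) _).hasDerivAt
      have h2 := (hgk.comp_hasFDerivAt _ hinner).smul_const (P.nodeVal t k)
      refine h2.congr_fderiv ?_
      ext; simp
    have h3 := HasFDerivAt.fun_sum (u := Finset.univ) fun k _ => h1 k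
    rw [Finset.sum_const_zero] at h3
    exact h3.fderiv
  refine ⟨⟨φ, exists_realizes_of_mem_dilateSpan hσ u g hg _, ?_⟩,
    ⟨(P.isOptimalMap_iff hℓ t).2 hopt, ?_, ?_⟩, hbound⟩
  · rw [isBounded_iff_forall_norm_le]
    exact ⟨_, Set.forall_mem_image.2 hbound⟩
  · change ContDiff ℝ _ fun y => ∑ i, g i (innerSL ℝ u y) • P.nodeVal t i
    refine ContDiff.sum fun i _ => ContDiff.fun_smul ?_ contDiff_const
    exact (hgsm i).comp (innerSL ℝ u).contDiff
  · rintro _ ⟨x, hx, rfl⟩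
    rw [P.initialDomain_trainingSet hℓ] at hx
    obtain ⟨i, rfl⟩ := hx
    simp [hder]

/-- All optimal networks share the prescribed value at a node, so the distance to each of them
bounds the error there. -/
theorem dist_le_of_infEDist_le {N m : ℕ} {A : Euc N →L[ℝ] Euc m} {a : ℝ} (P : KernelPair A a)
    {ℓ : ℕ} (hℓ : 0 < ℓ) {s : ℕ} {σ : Fin s → ℂ → ℂ} {t : Param} {ε : ℝ} (hε : 0 ≤ ε)
    {φ : NNSpace σ N (measurementSet A (P.collection ℓ) P.initialDomain)}
    (h : Metric.infEDist φ (optimalNNs σ A (P.collection ℓ) P.initialDomain (P.trainingSet ℓ t)) ≤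
      ENNReal.ofReal ε) (i : Fin ℓ ⊕ Bool) :
    dist (φ.1 (A (P.nodeVal t i))) (P.nodeVal t i) ≤ ε := by
  rw [← edist_le_ofReal hε]
  refine le_trans (Metric.le_infEDist.2 fun ψ hψ => ?_) h
  have h1 := (P.isOptimalMap_iff hℓ t).1 hψ i
  calc edist (φ.1 (A (P.nodeVal t i))) (P.nodeVal t i)
      = edist (φ.1 (A (P.nodeVal t i))) (ψ.1 (A (P.nodeVal t i))) := by rw [h1]
    _ ≤ edist φ ψ :=
      le_iSup₂ (f := fun y (_ : y ∈ measurementSet A (P.collection ℓ) P.initialDomain) =>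
        edist (φ.1 y) (ψ.1 y)) _ (P.map_nodeVal_mem_measurementSet t i)

theorem nodeVal_true_of_eq_zero {N m : ℕ} {A : Euc N →L[ℝ] Euc m} {a : ℝ} (P : KernelPair A a)
    {ℓ : ℕ} {t : Param} (ht : (t : ℝ) = 0) :
    P.nodeVal (ℓ := ℓ) t (.inr true) = -(a • P.v) := by
  simp [nodeVal, ht]

theorem nodeVal_true {N m : ℕ} {A : Euc N →L[ℝ] Euc m} {a : ℝ} (P : KernelPair A a)
    {ℓ : ℕ} {t : Param} (ht : (t : ℝ) ≠ 0) : P.nodeVal (ℓ := ℓ) t (.inr true) = a • P.v := by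
  simp [nodeVal, ht]

theorem map_nodeVal_true {N m : ℕ} {A : Euc N →L[ℝ] Euc m} {a : ℝ} (P : KernelPair A a)
    {ℓ : ℕ} (t : Param) : A (P.nodeVal (ℓ := ℓ) t (.inr true)) = 0 := by
  simp [map_nodeVal, nodeParam]

theorem norm_smul_v {N m : ℕ} {A : Euc N →L[ℝ] Euc m} {a : ℝ} (P : KernelPair A a) {r : ℝ}
    (hr : 0 ≤ r) : ‖r • P.v‖ = r := by
  rw [norm_smul, P.norm_v, mul_one, Real.norm_of_nonneg hr]

/-- The values `-a v` and `a v` prescribed at `0` have distance `2a > 2ε`. -/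
theorem lt_infEDist_of_infEDist_le {N m : ℕ} {A : Euc N →L[ℝ] Euc m} {a : ℝ} (P : KernelPair A a)
    {ℓ : ℕ} (hℓ : 0 < ℓ) {s : ℕ} {σ : Fin s → ℂ → ℂ} {t₀ t : Param} (ht₀ : (t₀ : ℝ) = 0)
    (ht : (t : ℝ) ≠ 0) {ε : ℝ} (hε : 0 ≤ ε) (hεa : ε < a)
    {φ : NNSpace σ N (measurementSet A (P.collection ℓ) P.initialDomain)}
    (h : Metric.infEDist φ (optimalNNs σ A (P.collection ℓ) P.initialDomain
      (P.trainingSet ℓ t₀)) ≤ ENNReal.ofReal ε) :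
    ENNReal.ofReal ε < Metric.infEDist φ (optimalNNs σ A (P.collection ℓ) P.initialDomain
      (P.trainingSet ℓ t)) := by
  by_contra! hcon
  have h1 := P.dist_le_of_infEDist_le hℓ hε h (.inr true)
  have h2 := P.dist_le_of_infEDist_le hℓ hε hcon (.inr true)
  rw [map_nodeVal_true, nodeVal_true_of_eq_zero P ht₀] at h1
  rw [map_nodeVal_true, nodeVal_true P ht] at h2
  have h3 : dist (a • P.v) (-(a • P.v)) = 2 * a := by
    rw [dist_eq_norm, sub_neg_eq_add, ← two_smul ℝ, smul_smul,
      P.norm_smul_v (by linarith [P.pos])]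
  have h4 := dist_triangle_left (a • P.v) (-(a • P.v)) (φ.1 0)
  linarith

/-- The difference of the two points is `(2 - t) a v - t w`, and the loss `2 t a` is at most `2 t`
since `a ≤ 1`. -/
theorem two_mul_sub_le_dist_nodeVal {N m : ℕ} {A : Euc N →L[ℝ] Euc m} {a : ℝ}
    (P : KernelPair A a) {ℓ : ℕ} {t : Param} (ht : (t : ℝ) ≠ 0) :
    2 * a - 2 * t ≤
      dist (P.nodeVal (ℓ := ℓ) t (.inr true)) (P.nodeVal (ℓ := ℓ) t (.inr false)) := by
  have h0 := t.2.1
  have h1 := t.2.2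
  have ha := P.pos
  have ha1 := P.le_one
  have h2 : a • P.v - ((t : ℝ) • P.w - ((1 - t) * a) • P.v) =
      ((2 - t) * a) • P.v - (t : ℝ) • P.w := by module
  have h3 : ‖(t : ℝ) • P.w‖ ≤ t * a := by
    rw [norm_smul, Real.norm_of_nonneg h0]
    exact mul_le_mul_of_nonneg_left P.norm_w h0
  have h4 := norm_sub_norm_le (((2 - t) * a) • P.v) ((t : ℝ) • P.w)
  rw [P.norm_smul_v (mul_nonneg (by linarith) ha.le)] at h4
  simp only [nodeVal, if_neg ht, dist_eq_norm]
  rw [h2]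
  nlinarith

end KernelPair

/-! ### Inexact inputs -/

/-- Rounding uses only half of the permitted error; the other half is room for moving the
measurement. -/
theorem abs_round_div_sub_le (x : ℝ) (n : ℕ) :
    |(round (x * 2 ^ n) : ℝ) / 2 ^ n - x| ≤ 1 / 2 / 2 ^ n := by
  have h2 : (0 : ℝ) < 2 ^ n := by positivity
  have h1 : (round (x * 2 ^ n) : ℝ) / 2 ^ n - x = (round (x * 2 ^ n) - x * 2 ^ n) / 2 ^ n := by
    field_simp
  rw [h1, abs_div, abs_of_pos h2, abs_sub_comm]
  exact div_le_div_of_nonneg_right (abs_sub_round _) h2.le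

theorem dyadicApprox_round (x : ℝ) : DyadicApprox (fun n => round (x * 2 ^ n)) x := fun n =>
  (abs_round_div_sub_le x n).trans
    (div_le_div_of_nonneg_right (by norm_num) (by positivity))

/-- The input which represents `T` by the nearest dyadic numbers. -/
noncomputable def roundedInput {N m ℓ : ℕ} {Ω : Set (TrainingSet N m ℓ)} {T : TrainingSet N m ℓ}
    (hT : T ∈ Ω) : InexactInput Ω :=
  ⟨(T, fun i n => round (T.meas i * 2 ^ n)), hT, fun i => dyadicApprox_round (T.meas i)⟩

/-- Nearest dyadic approximations up to a given precision do not change under small perturbations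
of the measurements. -/
theorem exists_input_agreeing {N m ℓ : ℕ} {Ω : Set (TrainingSet N m ℓ)} {T T' : TrainingSet N m ℓ}
    (hT : T ∈ Ω) (hT' : T' ∈ Ω) (B : ℕ)
    (hclose : ∀ i, |T.meas i - T'.meas i| ≤ 1 / 2 / 2 ^ B) :
    ∃ ι : InexactInput Ω, ι.1.1 = T' ∧
      ∀ q : MeasIdx N m ℓ × ℕ, q.2 ≤ B → inexactEval Ω q ι = inexactEval Ω q (roundedInput hT) := by
  refine ⟨⟨(T', fun i n => if n ≤ B then round (T.meas i * 2 ^ n) else round (T'.meas i * 2 ^ n)),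
    hT', fun i n => ?_⟩, rfl, fun q hq => ?_⟩
  · dsimp only
    split_ifs with hn
    · have h1 := abs_round_div_sub_le (T.meas i) n
      have h2 := abs_sub_le ((round (T.meas i * 2 ^ n) : ℝ) / 2 ^ n) (T.meas i) (T'.meas i)
      have h3 : (1 / 2 : ℝ) / 2 ^ B ≤ 1 / 2 / 2 ^ n :=
        div_le_div_of_nonneg_left (by norm_num) (by positivity)
          (pow_le_pow_right₀ (by norm_num) hn)
      have h4 : (1 : ℝ) / 2 ^ n = 1 / 2 / 2 ^ n + 1 / 2 / 2 ^ n := by ring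
      linarith [hclose i]
    · exact dyadicApprox_round (T'.meas i) n
  · simp [inexactEval, roundedInput, hq]

/-! ### Constant programs and the zero network -/

/-- A program that computes the constant `n`. -/
def OracleProgram.const : ℕ → OracleProgram
  | 0 => .zero
  | n + 1 => .comp .succ (OracleProgram.const n)

theorem OracleProgram.eval_const (g : ℕ → ℕ) (n k : ℕ) :
    (OracleProgram.const n).eval g k = Part.some n := by
  induction n with
  | zero => rfl
  | succ n ih => simp [OracleProgram.const, OracleProgram.eval, ih]

/-- The description of a network that computes the zero map. -/
def zeroNetCode (s : ℕ) : NetCode s := ([], [], [], [])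

theorem realizes_zeroNetCode {s m N : ℕ} (σ : Fin s → ℂ → ℂ) :
    ((zeroNetCode s).toNet m N).Realizes σ fun _ => 0 := by
  intro y i
  simp [NeuralNet.eval, NetCode.toNet, zeroNetCode, matOfLists, vecOfList, Matrix.mulVec,
    dotProduct]

/-! ### Indistinguishability, steepness and the zero network for the family. -/

namespace KernelPair

theorem indistinguishableAt {N m : ℕ} {A : Euc N →L[ℝ] Euc m} {a : ℝ} (P : KernelPair A a)
    {ℓ : ℕ} (hℓ : 0 < ℓ) {s : ℕ} (σ : Fin s → ℂ → ℂ) {ε : ℝ} (hε : 0 ≤ ε) (hεa : ε < a)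
    {t₀ : Param} (ht₀ : (t₀ : ℝ) = 0) :
    IndistinguishableAt (inexactEval (P.collection ℓ))
      (inexactOptimalNNs σ A (P.collection ℓ) P.initialDomain) (ENNReal.ofReal ε)
      (roundedInput (Set.mem_range_self (f := P.trainingSet ℓ) t₀)) := by
  intro S hS
  obtain ⟨B, hB⟩ := (hS.image Prod.snd).bddAbove
  -- Measurements move by at most `t`, which is the slack left by rounding at every precision up to
  -- `B`.
  let t : Param := ⟨1 / 2 / 2 ^ B, by positivity,
    div_le_self (by norm_num) (one_le_pow₀ (by norm_num))⟩
  have ht : (t : ℝ) ≠ 0 := ne_of_gt (by positivity : (0 : ℝ) < 1 / 2 / 2 ^ B)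
  obtain ⟨ι, hι, hag⟩ := exists_input_agreeing (Set.mem_range_self (f := P.trainingSet ℓ) t₀)
    (Set.mem_range_self (f := P.trainingSet ℓ) t) B fun i => P.abs_meas_sub_le t₀ t ht₀ i
  refine ⟨ι, fun q hq => hag q (hB (Set.mem_image_of_mem _ hq)), fun φ hφ => ?_⟩
  change _ < Metric.infEDist φ (optimalNNs σ A (P.collection ℓ) P.initialDomain ι.1.1)
  rw [hι]
  exact P.lt_infEDist_of_infEDist_le hℓ ht₀ ht hε hεa hφ

/-- Maps that approximate an optimal map for a small parameter are steep. -/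
theorem le_dist_of_infEDist_le {N m : ℕ} {A : Euc N →L[ℝ] Euc m} {a : ℝ} (P : KernelPair A a)
    {ℓ : ℕ} (hℓ : 0 < ℓ) {s : ℕ} {σ : Fin s → ℂ → ℂ} {t : Param} (ht : (t : ℝ) ≠ 0) {ε δ : ℝ}
    (hε : 0 ≤ ε) (hεa : ε ≤ a - δ) (hδ : 2 * t ≤ δ)
    {φ : NNSpace σ N (measurementSet A (P.collection ℓ) P.initialDomain)}
    (h : Metric.infEDist φ (optimalNNs σ A (P.collection ℓ) P.initialDomain
      (P.trainingSet ℓ t)) ≤ ENNReal.ofReal ε) :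
    δ ≤ dist (φ.1 0) (φ.1 ((t : ℝ) • A P.w)) ∧ dist (0 : Euc m) ((t : ℝ) • A P.w) ≤ t := by
  have h1 := P.dist_le_of_infEDist_le hℓ hε h (.inr true)
  have h2 := P.dist_le_of_infEDist_le hℓ hε h (.inr false)
  have h3 := P.two_mul_sub_le_dist_nodeVal (ℓ := ℓ) ht
  have hA : A (P.nodeVal (ℓ := ℓ) t (.inr false)) = (t : ℝ) • A P.w := by
    rw [map_nodeVal, nodeParam, if_neg ht]
  rw [map_nodeVal_true] at h1
  rw [hA] at h2
  constructor
  · have h4 := dist_triangle4 (P.nodeVal (ℓ := ℓ) t (.inr true)) (φ.1 0)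
      (φ.1 ((t : ℝ) • A P.w)) (P.nodeVal (ℓ := ℓ) t (.inr false))
    rw [dist_comm] at h1
    linarith
  · rw [dist_zero_left, norm_smul, Real.norm_of_nonneg t.2.1]
    exact mul_le_of_le_one_right t.2.1 P.norm_map_w

/-- The zero network approximates optimal networks to every accuracy above `a`, because all points
of the initial domains lie in the ball of radius `a` around `0`. -/
theorem infEDist_zero_le {N m : ℕ} {A : Euc N →L[ℝ] Euc m} {a : ℝ} (P : KernelPair A a)
    {ℓ : ℕ} (hℓ : 0 < ℓ) {s : ℕ} {σ : Fin s → ℂ → ℂ} {j : Fin s} {f : ℝ → ℝ}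
    (hf : ContDiff ℝ ((⊤ : ℕ∞) : WithTop ℕ∞) f)
    (hnp : ¬ ∃ p : Polynomial ℝ, ∀ t, f t = p.eval t)
    (hσ : ∀ t : ℝ, σ j (t : ℂ) = (f t : ℂ)) (t : Param) {ε : ℝ} (hε : a < ε)
    {φ : NNSpace σ N (measurementSet A (P.collection ℓ) P.initialDomain)}
    (hφ : ∀ y, φ.1 y = 0) :
    Metric.infEDist φ (optimalNNs σ A (P.collection ℓ) P.initialDomain
      (P.trainingSet ℓ t)) ≤ ENNReal.ofReal ε := by
  have ha := P.pos
  -- With this `η` the bound `(1 + η) * a` equals `ε`.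
  obtain ⟨ψ, hψ, hb⟩ := P.exists_optimal_network hℓ hf hnp hσ t (η := ε / a - 1)
    (by rw [sub_pos, lt_div_iff₀ ha]; linarith)
  refine (Metric.infEDist_le_edist_of_mem hψ.1).trans (iSup₂_le fun y hy => ?_)
  rw [edist_le_ofReal (by linarith), hφ, dist_zero_left]
  refine (hb y hy).trans (le_of_eq ?_)
  field_simp
  ring

end KernelPair

/-! ### Proof of the theorem. -/

theorem lipschitzWith_of_norm_fderiv_lt {E F : Type*} [NormedAddCommGroup E] [NormedSpace ℝ E]
    [NormedAddCommGroup F] [NormedSpace ℝ F] {φ : E → F} (hφ : Differentiable ℝ φ) {K : ℕ}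
    (hK : ∀ c, ‖fderiv ℝ φ c‖ < K) : LipschitzWith K φ :=
  lipschitzWith_of_nnnorm_fderiv_le hφ fun c => by
    rw [← NNReal.coe_le_coe]
    simpa using (hK c).le

theorem theorem5p2 (N m : ℕ) (hNm : m < N) (βmin βmax : ℝ) (hβ : 0 < βmin) (hββ : βmin ≤ βmax)
    (A : Euc N →L[ℝ] Euc m) (hA : A ≠ 0)
    (hsp : spectrum ℝ (A ∘L ContinuousLinearMap.adjoint A) ⊆ Set.Icc (βmin ^ 2) (βmax ^ 2))
    (s : ℕ) (σ : Fin s → ℂ → ℂ)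
    (hσ : ∃ (j : Fin s) (f : ℝ → ℝ), ContDiff ℝ ((⊤ : ℕ∞) : WithTop ℕ∞) f ∧
      (¬ ∃ p : Polynomial ℝ, ∀ t, f t = p.eval t) ∧ ∀ t : ℝ, σ j (t : ℂ) = (f t : ℂ))
    (ε₁ : ℚ) (hε₁ : 0 < ε₁) (hε₁' : ε₁ ≤ 3 / 8) (ℓ : ℕ) (hℓ : 2 ≤ ℓ) :
    ∃ (Ω : Set (TrainingSet N m ℓ)) (M₁ : TrainingSet N m ℓ → Set (Euc N)) (D : ℕ),
      IsTrainingDomain A Ω M₁ ∧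
      (∀ T ∈ Ω, (optimalNNsD σ A Ω M₁ D T).Nonempty) ∧
      -- no (randomised) general algorithm reaches accuracy `ε₁` on inexact input
      ((∀ p : ℝ, 0 ≤ p → p < 1 / 2 →
          ENNReal.ofReal ε₁ ≤
            strongProbBreakdown (inexactEval Ω) (inexactOptimalNNs σ A Ω M₁) p) ∧
        (∀ Γ : GeneralAlgorithm (inexactEval Ω) (NNSpace σ N (measurementSet A Ω M₁)),
          ∃ ι, ENNReal.ofReal ε₁ < outputError (inexactOptimalNNs σ A Ω M₁ ι) (Γ.out ι)) ∧
        (∀ R : RandomisedGeneralAlgorithm (inexactEval Ω)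
            (NNSpace σ N (measurementSet A Ω M₁)),
          ∃ ι, R.P ι {Γ | outputError (inexactOptimalNNs σ A Ω M₁ ι) (Γ.1.out ι) ≤
            ENNReal.ofReal ε₁} ≤ 1 / 2)) ∧
      -- instability of all maps from inputs to networks, in particular of all algorithms
      (∀ (K : ℕ) (δ : ℝ), 0 < δ → δ < ε₁ → ∀ ε : ℝ, (ε₁ : ℝ) < ε → ε ≤ 2 * ε₁ - δ →
        ∀ Γ : InexactInput Ω → NNSpace σ N (measurementSet A Ω M₁),
          (∀ ι, Metric.infEDist (Γ ι) (inexactOptimalNNs σ A Ω M₁ ι) ≤ ENNReal.ofReal ε) →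
          {T | T ∈ Ω ∧ ∀ ι : InexactInput Ω, ι.1.1 = T →
            (Differentiable ℝ (Γ ι).1 → ∃ c, (K : ℝ) ≤ ‖fderiv ℝ (Γ ι).1 c‖) ∧
            (∀ L : NNReal, LipschitzWith L (Γ ι).1 → (K : NNReal) ≤ L)}.Infinite) ∧
      -- a Turing algorithm that computes stable networks of any accuracy above `2 ε₁`
      (∃ (prog : OracleProgram) (K : ℕ), ∀ (ι : InexactInput Ω) (ε : ℝ) (e : ℕ → ℤ),
        2 * (ε₁ : ℝ) < ε → DyadicApprox e ε →
          ∃ (d : NetCode s) (φ : NNSpace σ N (measurementSet A Ω M₁)),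
            Encodable.encode d ∈ prog.eval (inputOracle ι.1.2 e) 0 ∧
            (d.toNet m N).Realizes σ φ.1 ∧
            Metric.infEDist φ (inexactOptimalNNs σ A Ω M₁ ι) ≤ ENNReal.ofReal ε ∧
            Differentiable ℝ φ.1 ∧ ∀ c, ‖fderiv ℝ φ.1 c‖ ≤ K) := by
  obtain ⟨j, f, hf, hnp, hσj⟩ := hσ
  have hε0 : (0 : ℝ) < ε₁ := by exact_mod_cast hε₁
  have hε1 : (ε₁ : ℝ) ≤ 3 / 8 := by
    have h := (Rat.cast_le (K := ℝ)).2 hε₁'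
    push_cast at h
    exact h
  have hℓ0 : 0 < ℓ := by lia
  -- The radius `2 ε₁` is at most `3/4`. It exceeds `ε₁`, as the breakdown requires, and is the
  -- threshold for the stability of the zero network.
  obtain ⟨P⟩ := KernelPair.nonempty hNm hA (a := 2 * ε₁) (by positivity) (by linarith)
  let t₀ : KernelPair.Param := ⟨0, le_rfl, by norm_num⟩
  have hind := P.indistinguishableAt hℓ0 σ hε0.le (by linarith) (t₀ := t₀) rfl
  refine ⟨P.collection ℓ, P.initialDomain, 0, P.isTrainingDomain ℓ, ?_,
    ⟨fun p _ hp => ?_, fun Γ => ?_, fun R => ?_⟩, ?_, ?_⟩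
  · rintro _ ⟨t, rfl⟩
    obtain ⟨φ, hφ, -⟩ := P.exists_optimal_network hℓ0 hf hnp hσj t one_pos
    exact ⟨φ, hφ⟩
  · exact le_strongProbBreakdown ENNReal.ofReal_ne_top (ENNReal.ofReal_pos.2 hε0) hind hp
  · exact Γ.exists_outputError_lt ENNReal.ofReal_ne_top hind
  · exact R.exists_success_le_half ENNReal.ofReal_ne_top hind
  · intro K δ hδ hδε ε hε hε2 Γ hΓ
    have hKpos : (0 : ℝ) < K + 2 := by positivity
    -- The denominator `K + 2` makes the slope `δ / t` exceed `K` strictly and also gives `2 * t ≤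
    -- δ` and `t ≤ 1/2`. The factor `n + 1` provides infinitely many parameters.
    let t : ℕ → KernelPair.Param := fun n => ⟨δ / (K + 2) / (n + 1), by positivity, by
      rw [div_div, div_le_iff₀ (by positivity)]
      have h1 : (0 : ℝ) ≤ K := by positivity
      have h2 : (1 : ℝ) ≤ n + 1 := by have := n.cast_nonneg (α := ℝ); linarith
      nlinarith⟩
    have htpos : ∀ n, (0 : ℝ) < t n := fun n => by
      change 0 < δ / (K + 2) / ((n : ℝ) + 1)
      positivity
    have htle : ∀ n, ((K : ℝ) + 2) * t n ≤ δ := fun n => by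
      have h2 : (1 : ℝ) ≤ n + 1 := by have := n.cast_nonneg (α := ℝ); linarith
      change ((K : ℝ) + 2) * (δ / (K + 2) / ((n : ℝ) + 1)) ≤ δ
      rw [← mul_div_assoc, mul_div_cancel₀ _ hKpos.ne']
      exact div_le_self hδ.le h2
    have htinj : Function.Injective t := by
      intro n n' h
      have h1 : δ / (K + 2) / ((n : ℝ) + 1) = δ / (K + 2) / ((n' : ℝ) + 1) :=
        congrArg Subtype.val h
      have h2 : (n : ℝ) + 1 = n' + 1 := by
        field_simp at h1
        linarith
      exact_mod_cast add_right_cancel h2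
    refine Set.infinite_of_injective_forall_mem ((P.trainingSet_injective hℓ0).comp htinj)
      fun n => ⟨⟨t n, rfl⟩, fun ι hι => ?_⟩
    have hinf := hΓ ι
    rw [inexactOptimalNNs, hι] at hinf
    obtain ⟨hfar, hnear⟩ := P.le_dist_of_infEDist_le hℓ0 (htpos n).ne' (by linarith) hε2
      (by nlinarith [htpos n, htle n, (K.cast_nonneg : (0 : ℝ) ≤ K)]) hinf
    have hlip : ∀ L : NNReal, LipschitzWith L (Γ ι).1 → (K : NNReal) < L := by
      intro L hL
      have h1 := hL.dist_le_mul 0 ((t n : ℝ) • A P.w)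
      have h2 : (L : ℝ) * dist (0 : Euc m) ((t n : ℝ) • A P.w) ≤ L * t n :=
        mul_le_mul_of_nonneg_left hnear L.2
      have h3 : ((K : ℝ) + 2) * t n ≤ L * t n := by linarith [htle n]
      have h4 := le_of_mul_le_mul_right h3 (htpos n)
      rw [← NNReal.coe_lt_coe]
      push_cast
      linarith
    refine ⟨fun hd => ?_, fun L hL => (hlip L hL).le⟩
    by_contra! hcon
    -- If all Jacobians had norm below `K`, the mean value inequality would make `K` a Lipschitz
    -- constant, against the strict bound `hlip`.
    exact lt_irrefl _ (hlip K (lipschitzWith_of_norm_fderiv_lt hd hcon))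
  -- The program returns the zero network without consulting the oracle; its Jacobian vanishes, so
  -- `K = 0`.
  · refine ⟨.const (Encodable.encode (zeroNetCode s)), 0, fun ι ε e hε he => ?_⟩
    let φ : NNSpace σ N (measurementSet A (P.collection ℓ) P.initialDomain) :=
      ⟨fun _ => 0, ⟨_, realizes_zeroNetCode σ⟩,
        Bornology.IsBounded.subset Bornology.isBounded_singleton
          (Set.image_subset_iff.2 fun _ _ => rfl)⟩
    refine ⟨zeroNetCode s, φ, ?_, realizes_zeroNetCode σ, ?_, differentiable_const _, fun c => ?_⟩
    · rw [OracleProgram.eval_const]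
      exact Part.mem_some _
    · obtain ⟨t, ht⟩ := ι.2.1
      rw [inexactOptimalNNs, ← ht]
      exact P.infEDist_zero_le hℓ0 hf hnp hσj t hε fun _ => rfl
    · change ‖fderiv ℝ (fun _ : Euc m => (0 : Euc N)) c‖ ≤ _
      simp
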